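/- There is a universal constant $C>0$ such that the following holds. Let $d\ge 0$ and let $T,\tau,k,h$ be integers with $\tau\ge 1$, $h\ge 1$, $\tau<k<T$ and $h<k$. Let $\alpha>0$ and $L_f,L_c\ge 0$, $\beta,L_g,G\in\mathbb R$. Let $\mathcal W\subseteq\mathbb R^d$ be convex with $\|x-y\|\le G$ for all $x,y\in\mathcal W$ (Euclidean norm). Let $(\mathcal F_t)_{t\ge 0}$ be a filtration on a probability space, let $F_t:\mathcal W^{h+1}\to\mathbb R$, $t\in\{0,\dots,T-1\}$, be random functions, and put $f_t(x)=F_t(x,\dots,x)$ for $x\in\mathcal W$. Suppose that: (i) for all $t\in\{0,\dots,T-1\}$ and $x\in\mathcal W$, the random variable $f_t(x)$ is integrable and $\mathcal F_t$-measurable; $f_t$ is $L_f$-Lipschitz on $\mathcal W$ and twice differentiable on $\mathcal W$, with $\|\nabla^2 f_t(x)\|\le\beta$ (operator norm) for all $x\in\mathcal W$; (ii) for all $t\in\{k,\dots,T-1\}$, the random function $x\mapsto\mathbb E[f_t(x)\mid\mathcal F_{t-k}]$ (that is, a version of it) is almost surely $\alpha$-strongly convex on $\mathcal W$; (iii) each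 $F_t$ is $L_c$-coordinatewise Lipschitz: $|F_t(x_0,\dots,x_j,\dots,x_h)-F_t(x_0,\dots,\tilde x_j,\dots,x_h)|\le L_c\|x_j-\tilde x_j\|$ for all $j$ and all arguments in $\mathcal W$; (iv) the random points $x_t$ are generated by projected gradient descent with delay $\tau$ and inexact gradients: $x_0=\dots=x_\tau\in\mathcal W$ and $$x_{t+1}=\Pi_{\mathcal W}\big(x_t-\eta_t\,g_{t-\tau}\big),\qquad \eta_t=\frac{3}{\alpha t},\qquad t\in\{\tau,\dots,T-1+\tau\},$$ where $\Pi_{\mathcal W}$ is the Euclidean projection onto $\mathcal W$, $g_t=\nabla f_t(x_t)+\varepsilon_t$, and $\|g_t\|\le L_g$ for all $t\in\{0,\dots,T-1\}$; and $x_t$ is $\mathcal F_t$-measurable for all $t\in\{0,\dots,T-1\}$. Then for every $\delta>0$, with probability at least $1-\delta$, for all $x_\star\in\mathcal W$ simultaneously, $$\begin{aligned}\sum_{t=k}^{T-1}\big(F_t(x_t,\dots,x_{t-h})-f_t(x_\star)\big)\le{}&-\frac{\alpha}{12}\sum_{t=0}^{T-1}\|x_t-x_\star\|^2+C\bigg(\sum_{t=k}^{T-1}\frac{\|\varepsilon_t\|^2}{\alpha}+\frac{k\,d\,L_f^2}{\alpha}\log\Big(\frac{T\,(1+\log_+(\alpha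 G^2))}{\delta}\Big)\\&+\alpha G^2(k+\tau)+\frac{L_g}{\alpha}\big(L_g\tau+(\beta G+L_f)k+L_ch^2\big)\log T\bigg),\end{aligned}$$ where $\log_+(x)=\log(\max\{1,x\})$. -/

import Mathlib

open MeasureTheory

namespace OCOMemory

/-- The unary function `x ↦ F (x, …, x)` induced by a function of `h + 1` arguments. -/
def unary {E : Type*} {h : ℕ} (F : (Fin (h + 1) → E) → ℝ) (x : E) : ℝ := F fun _ => x

/-- `p` is the metric projection of `z` onto `W`. -/
def IsProj {d : ℕ} (W : Set (EuclideanSpace ℝ (Fin d))) (z p : EuclideanSpace ℝ (Fin d)) :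
    Prop :=
  p ∈ W ∧ ∀ y ∈ W, ‖z - p‖ ≤ ‖z - y‖

/-- The random function `x ↦ 𝔼[f x | m]`, `x ∈ W`, is `α`-strongly convex on `W`: as a conditional
expectation is only defined up to null sets for each single `x`, this says that it has a version
that is almost surely an `α`-strongly convex function. -/
def CondStronglyConvex {Ω : Type*} {m₀ : MeasurableSpace Ω} (μ : Measure Ω)
    (m : MeasurableSpace Ω) {d : ℕ} (W : Set (EuclideanSpace ℝ (Fin d))) (α : ℝ)
    (f : Ω → EuclideanSpace ℝ (Fin d) → ℝ) : Prop :=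
  ∃ fc : Ω → EuclideanSpace ℝ (Fin d) → ℝ,
    (∀ x ∈ W, (fun ω => fc ω x) =ᵐ[μ] μ[fun ω => f ω x | m]) ∧
      ∀ᵐ ω ∂μ, StrongConvexOn W α (fc ω)

/-- Regularity of the random losses `f t : W → ℝ`, `t < T`: they are integrable and adapted to
the filtration, `Lf`-Lipschitz on `W`, twice differentiable on `W` with gradient `Df t` and
Hessian of operator norm at most `β`, and for `k ≤ t < T` the conditional expectation of `f t`
given `ℱ (t - k)` is `α`-strongly convex. Derivatives are taken within `W`; if `W` has an interior
point they are unique, and restrictions of derivatives on a neighbourhood of `W` qualify. -/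
structure Regularity {Ω : Type*} {m₀ : MeasurableSpace Ω} (μ : Measure Ω)
    (ℱ : Filtration ℕ m₀) {d : ℕ} (W : Set (EuclideanSpace ℝ (Fin d))) (T k : ℕ) (α β Lf : ℝ)
    (f : ℕ → Ω → EuclideanSpace ℝ (Fin d) → ℝ)
    (Df : ℕ → Ω → EuclideanSpace ℝ (Fin d) → EuclideanSpace ℝ (Fin d)) : Prop where
  adapted : ∀ t < T, ∀ x ∈ W, StronglyMeasurable[ℱ t] fun ω => f t ω x
  integrable : ∀ t < T, ∀ x ∈ W, Integrable (fun ω => f t ω x) μ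
  lipschitz : ∀ t < T, ∀ ω, ∀ x ∈ W, ∀ y ∈ W, |f t ω x - f t ω y| ≤ Lf * ‖x - y‖
  gradient : ∀ t < T, ∀ ω, ∀ x ∈ W, HasGradientWithinAt (f t ω) (Df t ω x) W x
  hessian : ∀ t < T, ∀ ω, ∀ x ∈ W,
    ∃ H : EuclideanSpace ℝ (Fin d) →L[ℝ] EuclideanSpace ℝ (Fin d),
      HasFDerivWithinAt (Df t ω) H W x ∧ ‖H‖ ≤ β
  condStronglyConvex : ∀ t, k ≤ t → t < T → CondStronglyConvex μ (ℱ (t - k)) W α (f t)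

/-- `F` is `Lc`-Lipschitz in each of its arguments on `W × ⋯ × W`. -/
def CoordLipschitz {d h : ℕ} (W : Set (EuclideanSpace ℝ (Fin d))) (Lc : ℝ)
    (F : (Fin (h + 1) → EuclideanSpace ℝ (Fin d)) → ℝ) : Prop :=
  ∀ z : Fin (h + 1) → EuclideanSpace ℝ (Fin d), (∀ i, z i ∈ W) →
    ∀ j, ∀ y ∈ W, |F z - F (Function.update z j y)| ≤ Lc * ‖z j - y‖

/-- `x` is a run of projected gradient descent on `W` with delay `τ`, horizon `T` and step sizes
`η`, in which `g s` is the gradient feedback for time `s`, available at time `s + τ`. -/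
structure IsDelayedPGD {d : ℕ} (W : Set (EuclideanSpace ℝ (Fin d))) (T τ : ℕ) (η : ℕ → ℝ)
    (g x : ℕ → EuclideanSpace ℝ (Fin d)) : Prop where
  init_mem : x 0 ∈ W
  init_eq : ∀ t ≤ τ, x t = x 0
  step : ∀ t, τ ≤ t → t < T + τ → IsProj W (x t - η t • g (t - τ)) (x (t + 1))

end OCOMemory

/-! The regret splits into a deterministic and a probabilistic part, joined by the first-order
defect `f c - f a - ⟪∇f c, c - a⟫ + const * ‖c - a‖²` (`gradDefect`) of `f_t` at the delayed iterate
`c = x_{t-k}` against the comparator `a = x_star`.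

Deterministic part (`IsDelayedPGD.regret_le`). Steps have size `O(Lg / (α s))`, so shifting indices
by up to `h`, `k` or `τ` costs a logarithm per unit of shift. One may therefore replace the memory
arguments by `x_t`, evaluate loss and gradient at `x_{t-k}`, and pair `g_t` with `x_{t+τ}`, the
point which the algorithm moves by means of `g_t`. The standard telescoping then pays `α/6` per
squared distance and the gradient errors pay `α/8`. A defect with coefficient `3/8 * α` offsets both
and leaves `-α/12`.

Probabilistic part (`exists_event_sum_gradDefect_le`). Since `x_{t-k}` is known at time `t - k`,
conditional strong convexity makes the defect with coefficient `α/2` nonpositive in conditional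
mean. Its linear part is `O(Lf * R)` with `R = ‖x_{t-k} - a‖`, so its conditional variance is `O(Lf²
R²)`. Lowering the coefficient to `7/16 * α` frees `α/16 * R²`, which absorbs this variance in an
exponential moment (`integral_mul_exp_gradDefect_le`). Along each residue class modulo `k` the
exponentials multiply to a supermartingale; Markov's inequality and a union bound over the `k`
classes and a grid of comparators follow, and lowering the coefficient to `3/8 * α` pays for passing
from the grid to all of `W`. Strong convexity and the Lipschitz bound force the diameter of `W`
below `4 * Lf / α`, so a grid with `2 * T + 1` cells per axis is fine enough. -/

namespace OCOMemory

/-! ### Gradients within a convex set. -/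

section Gradient

variable {E : Type*} [NormedAddCommGroup E] [InnerProductSpace ℝ E] [CompleteSpace E]

/-- Within a convex set, the difference quotients along a segment converge to the directional
derivative given by a gradient. -/
lemma tendsto_slope_of_hasGradientWithinAt {W : Set E} (hW : Convex ℝ W) {f : E → ℝ} {v y a : E}
    (hy : y ∈ W) (ha : a ∈ W) (hf : HasGradientWithinAt f v W y) :
    Filter.Tendsto (fun n : ℕ => ((n : ℝ) + 1) * (f (y + ((n : ℝ) + 1)⁻¹ • (a - y)) - f y))
      Filter.atTop (nhds (inner ℝ v (a - y))) := by
  have hf' := hasGradientWithinAt_iff_hasFDerivWithinAt.1 hf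
  have h0 : Filter.Tendsto (fun n : ℕ => ((n : ℝ) + 1)⁻¹) Filter.atTop (nhds 0) := by
    simpa using tendsto_one_div_add_atTop_nhds_zero_nat (𝕜 := ℝ)
  have := hf'.lim (l := Filter.atTop) (c := fun n : ℕ => (n : ℝ) + 1)
    (d := fun n : ℕ => ((n : ℝ) + 1)⁻¹ • (a - y)) (v := a - y)
    (by simpa using h0.smul_const (a - y)) ?_ ?_
  · simpa using this
  · refine Filter.Eventually.of_forall fun n => ?_
    have h1 : ((n : ℝ) + 1)⁻¹ ≤ 1 := inv_le_one_of_one_le₀ (by linarith [n.cast_nonneg (α := ℝ)])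
    exact hW.add_smul_sub_mem hy ha ⟨by positivity, h1⟩
  · refine tendsto_const_nhds.congr fun n => ?_
    have : ((n : ℝ) + 1) ≠ 0 := by positivity
    simp [smul_smul, this]

/-- A gradient within a convex set of a Lipschitz function is bounded along directions spanned by
the set. -/
lemma abs_inner_gradient_le {W : Set E} (hW : Convex ℝ W) {f : E → ℝ} {L : ℝ} {v y a b : E}
    (hL : ∀ x ∈ W, ∀ y ∈ W, |f x - f y| ≤ L * ‖x - y‖)
    (hy : y ∈ W) (ha : a ∈ W) (hb : b ∈ W) (hf : HasGradientWithinAt f v W y) :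
    |inner ℝ v (a - b)| ≤ L * ‖a - b‖ := by
  -- Both slopes start at `y`, so `f y` cancels and the Lipschitz bound compares two points of `W`
  -- that differ by `(a - b) / (n + 1)`. The norm of `v` itself need not be bounded, as `W` may span
  -- a proper subspace.
  have h := (tendsto_slope_of_hasGradientWithinAt hW hy ha hf).sub
    (tendsto_slope_of_hasGradientWithinAt hW hy hb hf)
  rw [← inner_sub_right, sub_sub_sub_cancel_right] at h
  refine le_of_tendsto h.abs (Filter.Eventually.of_forall fun n => ?_)
  have hn : (0 : ℝ) < (n : ℝ) + 1 := by positivity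
  have h1 : ((n : ℝ) + 1)⁻¹ ≤ 1 := inv_le_one_of_one_le₀ (by linarith [n.cast_nonneg (α := ℝ)])
  have h2 := hL _ (hW.add_smul_sub_mem hy ha ⟨by positivity, h1⟩) _
    (hW.add_smul_sub_mem hy hb ⟨by positivity, h1⟩)
  rw [add_sub_add_left_eq_sub, ← smul_sub, sub_sub_sub_cancel_right, norm_smul,
    Real.norm_of_nonneg (inv_pos.2 hn).le] at h2
  rw [← mul_sub, sub_sub_sub_cancel_right, abs_mul, abs_of_pos hn]
  calc _ ≤ ((n : ℝ) + 1) * (L * (((n : ℝ) + 1)⁻¹ * ‖a - b‖)) := by gcongr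
    _ = L * ‖a - b‖ := by field_simp

end Gradient

/-! ### Projected gradient descent with delay. -/

section Descent

variable {d : ℕ} {W : Set (EuclideanSpace ℝ (Fin d))}

/-- By convexity the angle at `p` between `z - p` and `y - p` is not acute; the law of cosines does
the rest. -/
lemma IsProj.norm_sub_le (hW : Convex ℝ W) {z p y : EuclideanSpace ℝ (Fin d)}
    (hp : IsProj W z p) (hy : y ∈ W) : ‖p - y‖ ≤ ‖z - y‖ := by
  have hinf : ‖z - p‖ = ⨅ w : W, ‖z - w‖ := by
    have : Nonempty W := ⟨⟨p, hp.1⟩⟩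
    refine le_antisymm (le_ciInf fun w => hp.2 w w.2) ?_
    exact ciInf_le ⟨0, by rintro _ ⟨w, rfl⟩; positivity⟩ (⟨p, hp.1⟩ : W)
  have h := (norm_eq_iInf_iff_real_inner_le_zero hW hp.1).1 hinf y hy
  have h2 : ‖z - y‖ ^ 2 = ‖z - p‖ ^ 2 - 2 * inner ℝ (z - p) (y - p) + ‖p - y‖ ^ 2 := by
    rw [norm_sub_rev p y, ← norm_sub_sq_real]; congr 2; abel
  exact le_of_sq_le_sq (by nlinarith [sq_nonneg ‖z - p‖]) (norm_nonneg _)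

/-- A coordinatewise Lipschitz function varies by at most the sum of the moves of its
arguments. -/
lemma CoordLipschitz.abs_sub_unary_le {h : ℕ} {Lc : ℝ}
    {F : (Fin (h + 1) → EuclideanSpace ℝ (Fin d)) → ℝ} (hF : CoordLipschitz W Lc F)
    {z : Fin (h + 1) → EuclideanSpace ℝ (Fin d)} (hz : ∀ i, z i ∈ W)
    {a : EuclideanSpace ℝ (Fin d)} (ha : a ∈ W) :
    |F z - unary F a| ≤ Lc * ∑ j, ‖z j - a‖ := by
  classical
  -- Arguments are replaced by `a` one at a time; `s` is the set of those already replaced.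
  have key : ∀ s : Finset (Fin (h + 1)),
      |F z - F (s.piecewise (fun _ => a) z)| ≤ Lc * ∑ j ∈ s, ‖z j - a‖ := by
    intro s
    induction s using Finset.induction_on with
    | empty => simp
    | insert j s hj ih =>
      rw [Finset.sum_insert hj, Finset.piecewise_insert, mul_add]
      have hmem : ∀ i, s.piecewise (fun _ => a) z i ∈ W := fun i => by
        by_cases hi : i ∈ s <;> simp [hi, ha, hz]
      have h1 := hF _ hmem j a ha
      rw [Finset.piecewise_eq_of_notMem _ _ _ hj] at h1
      have h2 := abs_sub_le (F z) (F (s.piecewise (fun _ => a) z))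
        (F (Function.update (s.piecewise (fun _ => a) z) j a))
      linarith
  have := key Finset.univ
  rwa [Finset.piecewise_univ] at this

lemma sum_mul_sub_succ (a : ℕ → ℝ) {m n : ℕ} (hmn : m ≤ n) :
    ∑ s ∈ Finset.Ico m n, (s : ℝ) * (a s - a (s + 1))
      = m * a m - n * a n + ∑ s ∈ Finset.Ico m n, a (s + 1) := by
  induction n, hmn using Nat.le_induction with
  | base => simp
  | succ n hn ih =>
    rw [Finset.sum_Ico_succ_top hn, Finset.sum_Ico_succ_top hn, ih]; push_cast; ring

lemma sum_Ico_comp_le_sum_range {φ : ℕ → ℝ} (hφ : ∀ s, 0 ≤ φ s) {k T N : ℕ} (σ : ℕ → ℕ)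
    (hinj : Set.InjOn σ (Finset.Ico k T)) (hσ : ∀ t, k ≤ t → t < T → σ t < N) :
    ∑ t ∈ Finset.Ico k T, φ (σ t) ≤ ∑ s ∈ Finset.range N, φ s := by
  rw [← Finset.sum_image (f := φ) hinj]
  refine Finset.sum_le_sum_of_subset_of_nonneg ?_ fun s _ _ => hφ s
  intro s hs
  obtain ⟨t, ht, rfl⟩ := Finset.mem_image.1 hs
  rw [Finset.mem_Ico] at ht
  exact Finset.mem_range.2 (hσ t ht.1 ht.2)

lemma sum_range_inv_le (T : ℕ) : ∑ s ∈ Finset.range T, (s : ℝ)⁻¹ ≤ 1 + Real.log T := by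
  rcases T with _ | n
  · simp
  · have h := harmonic_le_one_add_log n
    have h2 : ((harmonic n : ℚ) : ℝ) = ∑ s ∈ Finset.range (n + 1), (s : ℝ)⁻¹ := by
      rw [Finset.sum_range_succ']; simp [harmonic]
    rw [← h2]
    refine h.trans ?_
    rcases n.eq_zero_or_pos with rfl | hn
    · simp
    · gcongr; simp

lemma norm_add_sub_le_sum {E : Type*} [SeminormedAddCommGroup E] (x : ℕ → E) (s n : ℕ) :
    ‖x (s + n) - x s‖ ≤ ∑ i ∈ Finset.range n, ‖x (s + i + 1) - x (s + i)‖ := by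
  induction n with
  | zero => simp
  | succ n ih =>
    rw [Finset.sum_range_succ]
    have := norm_sub_le_norm_sub_add_norm_sub (x (s + (n + 1))) (x (s + n)) (x s)
    rw [← add_assoc] at this ⊢
    linarith

section Run

variable {T τ k : ℕ} {α Lg : ℝ} {g x : ℕ → EuclideanSpace ℝ (Fin d)}

lemma IsDelayedPGD.mem {η : ℕ → ℝ} (hx : IsDelayedPGD W T τ η g x) {t : ℕ} (ht : t ≤ T + τ) :
    x t ∈ W := by
  by_cases h : t ≤ τ
  · rw [hx.init_eq t h]; exact hx.init_mem
  · obtain ⟨s, rfl⟩ : ∃ s, t = s + 1 := ⟨t - 1, by omega⟩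
    exact (hx.step s (by omega) (by omega)).1

/-- The projection does not increase the distance to `x s`, a point of `W`. At `s = 0` the right
side is `0` because `0⁻¹ = 0`, which is correct since the iterates rest until time `τ ≥ 1`. -/
lemma IsDelayedPGD.norm_step_le (hW : Convex ℝ W) (hα : 0 < α) (hτ : 1 ≤ τ)
    (hx : IsDelayedPGD W T τ (fun t => 3 / (α * t)) g x) (hg : ∀ t < T, ‖g t‖ ≤ Lg)
    (hLg : 0 ≤ Lg) {s : ℕ} (hs : s < T + τ) :
    ‖x (s + 1) - x s‖ ≤ 3 * Lg / α * (s : ℝ)⁻¹ := by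
  by_cases h : s < τ
  · rw [hx.init_eq s h.le, hx.init_eq (s + 1) h, sub_self, norm_zero]; positivity
  · have h1 := (hx.step s (by omega) hs).norm_sub_le hW (hx.mem hs.le)
    rw [sub_sub_cancel_left, norm_neg, norm_smul,
      Real.norm_of_nonneg (div_nonneg zero_le_three (by positivity))] at h1
    have hs0 : (0 : ℝ) < s := by exact_mod_cast (show 0 < s by omega)
    calc _ ≤ 3 / (α * s) * Lg := h1.trans (by gcongr; exact hg _ (by omega))
      _ = _ := by field_simp

lemma IsDelayedPGD.sum_norm_sub_backward_le (hW : Convex ℝ W) (hα : 0 < α) (hτ : 1 ≤ τ)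
    (hx : IsDelayedPGD W T τ (fun t => 3 / (α * t)) g x) (hg : ∀ t < T, ‖g t‖ ≤ Lg)
    (hLg : 0 ≤ Lg) {n : ℕ} (hn : n ≤ k) :
    ∑ t ∈ Finset.Ico k T, ‖x t - x (t - n)‖ ≤ n * (3 * Lg / α * (1 + Real.log T)) := by
  calc _ ≤ ∑ t ∈ Finset.Ico k T, ∑ i ∈ Finset.range n, 3 * Lg / α * ((t - n + i : ℕ) : ℝ)⁻¹ := by
        refine Finset.sum_le_sum fun t ht => ?_
        rw [Finset.mem_Ico] at ht
        have h := norm_add_sub_le_sum x (t - n) n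
        rw [Nat.sub_add_cancel (hn.trans ht.1)] at h
        refine h.trans (Finset.sum_le_sum fun i hi => ?_)
        rw [Finset.mem_range] at hi
        exact hx.norm_step_le hW hα hτ hg hLg (by omega)
    -- For fixed `i` the index `t - n + i` is injective in `t` and stays below `T`, so each inner
    -- sum is part of a harmonic sum.
    _ = ∑ i ∈ Finset.range n, ∑ t ∈ Finset.Ico k T, 3 * Lg / α * ((t - n + i : ℕ) : ℝ)⁻¹ :=
        Finset.sum_comm
    _ ≤ ∑ i ∈ Finset.range n, 3 * Lg / α * (1 + Real.log T) := by
        refine Finset.sum_le_sum fun i hi => ?_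
        rw [Finset.mem_range] at hi
        rw [← Finset.mul_sum]
        gcongr
        refine le_trans ?_ (sum_range_inv_le T)
        refine sum_Ico_comp_le_sum_range (φ := fun s => (s : ℝ)⁻¹) (fun s => by positivity)
          (fun t => t - n + i) ?_ fun t _ _ => by omega
        intro t ht t' ht' h
        simp only [Finset.coe_Ico, Set.mem_Ico] at ht ht' h
        omega
    _ = _ := by simp

lemma IsDelayedPGD.sum_norm_sub_forward_le (hW : Convex ℝ W) (hα : 0 < α) (hτ : 1 ≤ τ)
    (hk : 1 ≤ k) (hx : IsDelayedPGD W T τ (fun t => 3 / (α * t)) g x)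
    (hg : ∀ t < T, ‖g t‖ ≤ Lg) (hLg : 0 ≤ Lg) :
    ∑ t ∈ Finset.Ico k T, ‖x (t + τ) - x t‖ ≤ τ * (3 * Lg / α * (1 + Real.log T)) := by
  calc _ ≤ ∑ t ∈ Finset.Ico k T, τ * (3 * Lg / α * (t : ℝ)⁻¹) := by
        refine Finset.sum_le_sum fun t ht => ?_
        rw [Finset.mem_Ico] at ht
        have ht0 : (0 : ℝ) < t := by exact_mod_cast (show 0 < t by omega)
        refine (norm_add_sub_le_sum x t τ).trans ?_
        calc _ ≤ ∑ i ∈ Finset.range τ, 3 * Lg / α * (t : ℝ)⁻¹ := by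
              refine Finset.sum_le_sum fun i hi => ?_
              rw [Finset.mem_range] at hi
              refine (hx.norm_step_le hW hα hτ hg hLg (by omega)).trans ?_
              gcongr; simp
          _ = _ := by simp
    _ = τ * (3 * Lg / α * ∑ t ∈ Finset.Ico k T, (t : ℝ)⁻¹) := by
        rw [Finset.mul_sum, Finset.mul_sum]
    _ ≤ _ := by
        gcongr
        refine le_trans ?_ (sum_range_inv_le T)
        exact sum_Ico_comp_le_sum_range (φ := fun s => (s : ℝ)⁻¹) (fun s => by positivity)
          id (Set.injOn_id _) fun t _ h => h

/-- One step of projected gradient descent. -/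
lemma IsDelayedPGD.inner_le (hW : Convex ℝ W) (hα : 0 < α) (hτ : 1 ≤ τ)
    (hx : IsDelayedPGD W T τ (fun t => 3 / (α * t)) g x) (hg : ∀ t < T, ‖g t‖ ≤ Lg)
    {xs : EuclideanSpace ℝ (Fin d)} (hxs : xs ∈ W) {t : ℕ} (ht : t < T) :
    inner ℝ (g t) (x (t + τ) - xs)
      ≤ α / 6 * ((t + τ : ℕ) * (‖x (t + τ) - xs‖ ^ 2 - ‖x (t + τ + 1) - xs‖ ^ 2))
        + 3 / (2 * α) * Lg ^ 2 * ((t + τ : ℕ) : ℝ)⁻¹ := by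
  have h1 := (hx.step (t + τ) (by omega) (by omega)).norm_sub_le hW hxs
  rw [Nat.add_sub_cancel] at h1
  have hs0 : (0 : ℝ) < ((t + τ : ℕ) : ℝ) := by exact_mod_cast (show 0 < t + τ by omega)
  generalize ((t + τ : ℕ) : ℝ) = s at *
  generalize x (t + τ + 1) = p at *
  generalize x (t + τ) = y at *
  have h2 : ‖p - xs‖ ^ 2 ≤ ‖y - xs‖ ^ 2 - 2 * (3 / (α * s) * inner ℝ (g t) (y - xs))
      + (3 / (α * s)) ^ 2 * Lg ^ 2 := by
    calc _ ≤ ‖y - (3 / (α * s)) • g t - xs‖ ^ 2 := by gcongr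
      _ = ‖(y - xs) - (3 / (α * s)) • g t‖ ^ 2 := by congr 2; abel
      _ = ‖y - xs‖ ^ 2 - 2 * (3 / (α * s) * inner ℝ (g t) (y - xs))
          + (3 / (α * s)) ^ 2 * ‖g t‖ ^ 2 := by
        rw [norm_sub_sq_real, inner_smul_right, real_inner_comm, norm_smul, mul_pow,
          Real.norm_eq_abs, sq_abs]
      _ ≤ _ := by gcongr; exact hg t ht
  -- The factor `α * s / 6` is `1 / (2 * η_s)`.
  have h3 := mul_le_mul_of_nonneg_left h2 (show 0 ≤ α * s / 6 by positivity)
  have e : α * s / 6 * (‖y - xs‖ ^ 2 - 2 * (3 / (α * s) * inner ℝ (g t) (y - xs))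
      + (3 / (α * s)) ^ 2 * Lg ^ 2) = α * s / 6 * ‖y - xs‖ ^ 2 - inner ℝ (g t) (y - xs)
      + 3 / (2 * α) * Lg ^ 2 * s⁻¹ := by field_simp; ring
  rw [e] at h3
  linarith

lemma IsDelayedPGD.sum_inner_le (hW : Convex ℝ W) (hα : 0 < α) (hτ : 1 ≤ τ) (hk : 1 ≤ k)
    (hkT : k ≤ T) {G : ℝ} (hG : ∀ y ∈ W, ∀ z ∈ W, ‖y - z‖ ≤ G)
    (hx : IsDelayedPGD W T τ (fun t => 3 / (α * t)) g x) (hg : ∀ t < T, ‖g t‖ ≤ Lg)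
    {xs : EuclideanSpace ℝ (Fin d)} (hxs : xs ∈ W) :
    ∑ t ∈ Finset.Ico k T, inner ℝ (g t) (x (t + τ) - xs)
      ≤ α / 6 * ((k + 2 * τ + 1) * G ^ 2 + ∑ t ∈ Finset.range T, ‖x t - xs‖ ^ 2)
        + 3 / (2 * α) * Lg ^ 2 * (1 + Real.log T) := by
  have ha : ∀ t ≤ T + τ, ‖x t - xs‖ ^ 2 ≤ G ^ 2 := fun t ht => by
    gcongr; exact hG _ (hx.mem ht) _ hxs
  set a : ℕ → ℝ := fun t => ‖x t - xs‖ ^ 2 with ha_def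
  have ha0 : ∀ t, 0 ≤ a t := fun t => sq_nonneg _
  have h1 : ∑ t ∈ Finset.Ico k T, ((t + τ : ℕ) : ℝ) * (a (t + τ) - a (t + τ + 1))
      -- Summation by parts leaves the boundary term `(k + τ) * G ^ 2`; the shifted sum exceeds
      -- `range T` by `τ + 1` terms of size at most `G ^ 2`.
      ≤ (k + 2 * τ + 1) * G ^ 2 + ∑ t ∈ Finset.range T, a t := by
    have e := Finset.sum_Ico_add' (fun s : ℕ => (s : ℝ) * (a s - a (s + 1))) k T τ
    rw [e, sum_mul_sub_succ a (by omega), ← Finset.sum_Ico_add' (fun s : ℕ => a (s + 1)) k T τ]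
    have h2 : ∑ t ∈ Finset.Ico k T, a (t + τ + 1) ≤ ∑ s ∈ Finset.range (T + (τ + 1)), a s :=
      sum_Ico_comp_le_sum_range ha0 (fun t => t + τ + 1)
        (fun t _ t' _ h => by simpa using h) fun t _ _ => by omega
    rw [Finset.sum_range_add] at h2
    have h3 : ∑ i ∈ Finset.range (τ + 1), a (T + i) ≤ ∑ i ∈ Finset.range (τ + 1), G ^ 2 :=
      Finset.sum_le_sum fun i hi => ha _ (by rw [Finset.mem_range] at hi; omega)
    rw [Finset.sum_const, Finset.card_range, nsmul_eq_mul] at h3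
    have h4 : ((k + τ : ℕ) : ℝ) * a (k + τ) ≤ ((k + τ : ℕ) : ℝ) * G ^ 2 := by
      gcongr; exact ha _ (by omega)
    have h5 : 0 ≤ ((T + τ : ℕ) : ℝ) * a (T + τ) := mul_nonneg (by positivity) (ha0 _)
    push_cast at h3 h4 h5 ⊢
    nlinarith
  have h6 : ∑ t ∈ Finset.Ico k T, ((t + τ : ℕ) : ℝ)⁻¹ ≤ 1 + Real.log T := by
    refine le_trans ?_ (sum_range_inv_le T)
    calc _ ≤ ∑ t ∈ Finset.Ico k T, (t : ℝ)⁻¹ := by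
          refine Finset.sum_le_sum fun t ht => ?_
          rw [Finset.mem_Ico] at ht
          have ht0 : (0 : ℝ) < t := by exact_mod_cast (show 0 < t by omega)
          gcongr; simp
      _ ≤ _ := sum_Ico_comp_le_sum_range (φ := fun s => (s : ℝ)⁻¹) (fun s => by positivity)
          id (Set.injOn_id _) fun t _ h => h
  calc _ ≤ ∑ t ∈ Finset.Ico k T, (α / 6 * (((t + τ : ℕ) : ℝ) * (a (t + τ) - a (t + τ + 1)))
        + 3 / (2 * α) * Lg ^ 2 * ((t + τ : ℕ) : ℝ)⁻¹) :=
        Finset.sum_le_sum fun t ht => hx.inner_le hW hα hτ hg hxs (Finset.mem_Ico.1 ht).2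
    _ = α / 6 * ∑ t ∈ Finset.Ico k T, ((t + τ : ℕ) : ℝ) * (a (t + τ) - a (t + τ + 1))
        + 3 / (2 * α) * Lg ^ 2 * ∑ t ∈ Finset.Ico k T, ((t + τ : ℕ) : ℝ)⁻¹ := by
        rw [Finset.sum_add_distrib, Finset.mul_sum, Finset.mul_sum]
    _ ≤ _ := by gcongr

end Run

end Descent

/-! ### Deterministic regret bound. -/

/-- The deterministic part of the regret analysis: a bound on the regret of delayed projected
gradient descent, in terms of the strong convexity defect of the losses at the delayed iterates. -/
lemma IsDelayedPGD.regret_le {d T τ k h : ℕ} {W : Set (EuclideanSpace ℝ (Fin d))}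
    {α β Lf Lc Lg G N : ℝ} {F : ℕ → (Fin (h + 1) → EuclideanSpace ℝ (Fin d)) → ℝ}
    {Df : ℕ → EuclideanSpace ℝ (Fin d) → EuclideanSpace ℝ (Fin d)}
    {ε x : ℕ → EuclideanSpace ℝ (Fin d)} {xs : EuclideanSpace ℝ (Fin d)}
    (hτ : 1 ≤ τ) (hτk : τ < k) (hkT : k < T) (hhk : h < k)
    (hα : 0 < α) (hβ : 0 ≤ β) (hLf : 0 ≤ Lf) (hLc : 0 ≤ Lc) (hW : Convex ℝ W)
    (hlip : ∀ t < T, ∀ y ∈ W, ∀ z ∈ W, |unary (F t) y - unary (F t) z| ≤ Lf * ‖y - z‖)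
    (hgrad : ∀ t < T, ∀ y ∈ W, ∀ a ∈ W, ∀ b ∈ W, |inner ℝ (Df t y) (a - b)| ≤ Lf * ‖a - b‖)
    (hhess : ∀ t < T, ∀ y ∈ W, ∀ z ∈ W, ‖Df t y - Df t z‖ ≤ β * ‖y - z‖)
    (hF : ∀ t < T, CoordLipschitz W Lc (F t))
    (hG : ∀ y ∈ W, ∀ z ∈ W, ‖y - z‖ ≤ G)
    (hg : ∀ t < T, ‖Df t (x t) + ε t‖ ≤ Lg)
    (hx : IsDelayedPGD W T τ (fun t => 3 / (α * t)) (fun t => Df t (x t) + ε t) x)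
    (hxs : xs ∈ W)
    (hN : ∑ t ∈ Finset.Ico k T, (unary (F t) (x (t - k)) - unary (F t) xs
      - inner ℝ (Df t (x (t - k))) (x (t - k) - xs) + 3 / 8 * α * ‖x (t - k) - xs‖ ^ 2) ≤ N) :
    ∑ t ∈ Finset.Ico k T, (F t (fun j : Fin (h + 1) => x (t - (j : ℕ))) - unary (F t) xs)
      ≤ -(α / 12) * ∑ t ∈ Finset.range T, ‖x t - xs‖ ^ 2 + N
        + 2 * ∑ t ∈ Finset.Ico k T, ‖ε t‖ ^ 2 / α + 2 * (α * G ^ 2 * (k + τ))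
        + 6 * (Lg / α * (Lg * τ + (β * G + Lf) * k + Lc * h ^ 2) * (1 + Real.log T)) := by
  have hLg : 0 ≤ Lg := (norm_nonneg _).trans (hg 0 (by omega))
  have hG0 : 0 ≤ G := (norm_nonneg _).trans (hG _ hxs _ hxs)
  have hxm : ∀ t ≤ T + τ, x t ∈ W := fun t ht => hx.mem ht
  have hΛ : 0 ≤ 1 + Real.log T := by positivity
  -- pointwise decomposition of the regret
  have hpt : ∀ t ∈ Finset.Ico k T,
      F t (fun j : Fin (h + 1) => x (t - (j : ℕ))) - unary (F t) xs
      ≤ Lc * ∑ j ∈ Finset.range (h + 1), ‖x t - x (t - j)‖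
        + (β * G + 2 * Lf) * ‖x t - x (t - k)‖
        + (unary (F t) (x (t - k)) - unary (F t) xs
          - inner ℝ (Df t (x (t - k))) (x (t - k) - xs) + 3 / 8 * α * ‖x (t - k) - xs‖ ^ 2)
        - 3 / 8 * α * ‖x (t - k) - xs‖ ^ 2
        + inner ℝ (Df t (x t) + ε t) (x (t + τ) - xs) + Lg * ‖x (t + τ) - x t‖
        + 2 * (‖ε t‖ ^ 2 / α) + α / 8 * ‖x t - xs‖ ^ 2 := by
    intro t ht
    rw [Finset.mem_Ico] at ht
    obtain ⟨hkt, htT⟩ := ht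
    have hxt := hxm t (by omega)
    have hy := hxm (t - k) (by omega)
    have hz := hxm (t + τ) (by omega)
    have h1 := (hF t htT).abs_sub_unary_le (z := fun j : Fin (h + 1) => x (t - (j : ℕ)))
      (fun j => hxm _ (by omega)) hxt
    rw [Fin.sum_univ_eq_sum_range (fun j => ‖x (t - j) - x t‖)] at h1
    simp only [norm_sub_rev _ (x t)] at h1
    have h2 := hlip t htT _ hxt _ hy
    -- With `h2` this gives the two multiples of `Lf`: one for moving the loss value, one for moving
    -- the base point of the inner product; `h4` then swaps the gradient.
    have h3 := hgrad t htT _ hxt _ hy _ hxt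
    rw [norm_sub_rev] at h3
    have h4 : inner ℝ (Df t (x (t - k)) - Df t (x t)) (x (t - k) - xs)
        ≤ β * G * ‖x t - x (t - k)‖ := by
      calc _ ≤ ‖Df t (x (t - k)) - Df t (x t)‖ * ‖x (t - k) - xs‖ := real_inner_le_norm _ _
        _ ≤ β * ‖x (t - k) - x t‖ * G := by
          gcongr
          · exact hhess t htT _ hy _ hxt
          · exact hG _ hy _ hxs
        _ = _ := by rw [norm_sub_rev]; ring
    have h5 : inner ℝ (Df t (x t) + ε t) (x t - x (t + τ)) ≤ Lg * ‖x (t + τ) - x t‖ := by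
      calc _ ≤ ‖Df t (x t) + ε t‖ * ‖x t - x (t + τ)‖ := real_inner_le_norm _ _
        _ ≤ _ := by rw [norm_sub_rev]; gcongr; exact hg t htT
    have h6 : -inner ℝ (ε t) (x t - xs) ≤ 2 * (‖ε t‖ ^ 2 / α) + α / 8 * ‖x t - xs‖ ^ 2 := by
      have h7 : -inner ℝ (ε t) (x t - xs) ≤ ‖ε t‖ * ‖x t - xs‖ :=
        (neg_le_abs _).trans (abs_real_inner_le_norm _ _)
      have h8 : 2 * (‖ε t‖ ^ 2 / α) + α / 8 * ‖x t - xs‖ ^ 2 - ‖ε t‖ * ‖x t - xs‖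
          = 1 / (8 * α) * (4 * ‖ε t‖ - α * ‖x t - xs‖) ^ 2 := by field_simp; ring
      have h9 : 0 ≤ 1 / (8 * α) * (4 * ‖ε t‖ - α * ‖x t - xs‖) ^ 2 := by positivity
      linarith
    have h1' := le_abs_self (F t (fun j : Fin (h + 1) => x (t - (j : ℕ))) - unary (F t) (x t))
    have h2' := le_abs_self (unary (F t) (x t) - unary (F t) (x (t - k)))
    have h3' := le_abs_self (inner ℝ (Df t (x t)) (x (t - k) - x t))
    simp only [inner_sub_left, inner_sub_right, inner_add_left] at *
    linarith
  -- the shifted squared distances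
  have ha : ∀ t ≤ T + τ, ‖x t - xs‖ ^ 2 ≤ G ^ 2 := fun t ht => by
    gcongr; exact hG _ (hxm t ht) _ hxs
  have hshift : ∑ t ∈ Finset.range T, ‖x t - xs‖ ^ 2
      ≤ ∑ t ∈ Finset.Ico k T, ‖x (t - k) - xs‖ ^ 2 + k * G ^ 2 := by
    rw [Finset.sum_Ico_eq_sum_range]
    simp only [Nat.add_sub_cancel_left]
    conv_lhs => rw [show T = T - k + k by omega, Finset.sum_range_add]
    gcongr
    calc _ ≤ ∑ i ∈ Finset.range k, G ^ 2 :=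
          Finset.sum_le_sum fun i hi => ha _ (by rw [Finset.mem_range] at hi; omega)
      _ = _ := by simp
  have htail : ∑ t ∈ Finset.Ico k T, ‖x t - xs‖ ^ 2 ≤ ∑ t ∈ Finset.range T, ‖x t - xs‖ ^ 2 :=
    sum_Ico_comp_le_sum_range (φ := fun t => ‖x t - xs‖ ^ 2) (fun s => sq_nonneg _)
      id (Set.injOn_id _) fun t _ h => h
  have hback : ∀ n ≤ k, ∑ t ∈ Finset.Ico k T, ‖x t - x (t - n)‖
      ≤ n * (3 * Lg / α * (1 + Real.log T)) :=
    fun n hn => hx.sum_norm_sub_backward_le hW hα hτ hg hLg hn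
  have hforw := hx.sum_norm_sub_forward_le hW hα hτ (show 1 ≤ k by omega) hg hLg
  have hinner := hx.sum_inner_le hW hα hτ (show 1 ≤ k by omega) hkT.le hG hg hxs
  have hmem : ∑ t ∈ Finset.Ico k T, ∑ j ∈ Finset.range (h + 1), ‖x t - x (t - j)‖
      ≤ h ^ 2 * (3 * Lg / α * (1 + Real.log T)) := by
    rw [Finset.sum_comm, Finset.sum_range_succ']
    simp only [Nat.sub_zero, sub_self, norm_zero, Finset.sum_const_zero, add_zero]
    calc _ ≤ ∑ j ∈ Finset.range h, h * (3 * Lg / α * (1 + Real.log T)) := by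
          refine Finset.sum_le_sum fun j hj => ?_
          rw [Finset.mem_range] at hj
          refine (hback (j + 1) (by omega)).trans ?_
          gcongr; omega
      _ = _ := by simp; ring
  have hsum := Finset.sum_le_sum hpt
  simp only [Finset.sum_add_distrib, Finset.sum_sub_distrib, ← Finset.mul_sum] at hsum hN ⊢
  have hk1 := hback k le_rfl
  have q1 := mul_le_mul_of_nonneg_left hmem hLc
  have q2 := mul_le_mul_of_nonneg_left hk1 (show 0 ≤ β * G + 2 * Lf by positivity)
  have q3 := mul_le_mul_of_nonneg_left hforw hLg
  have q4 := mul_le_mul_of_nonneg_left hshift (show 0 ≤ 3 / 8 * α by positivity)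
  have q5 := mul_le_mul_of_nonneg_left htail (show 0 ≤ α / 8 by positivity)
  have hτ1 : (1 : ℝ) ≤ τ := by exact_mod_cast hτ
  have hτk' : (τ : ℝ) ≤ k := by exact_mod_cast hτk.le
  have r1 : 3 / (2 * α) * Lg ^ 2 * (1 + Real.log T)
      ≤ 3 / 2 * (Lg / α * (Lg * τ) * (1 + Real.log T)) := by
    have : 0 ≤ Lg / α * Lg * (1 + Real.log T) := by positivity
    calc _ = 3 / 2 * (Lg / α * Lg * (1 + Real.log T) * 1) := by field_simp
      _ ≤ 3 / 2 * (Lg / α * Lg * (1 + Real.log T) * τ) := by gcongr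
      _ = _ := by ring
  have r2 : Lg * (τ * (3 * Lg / α * (1 + Real.log T)))
      = 3 * (Lg / α * (Lg * τ) * (1 + Real.log T)) := by ring
  have r3 : Lc * (h ^ 2 * (3 * Lg / α * (1 + Real.log T)))
      = 3 * (Lg / α * (Lc * h ^ 2) * (1 + Real.log T)) := by ring
  have r4 : (β * G + 2 * Lf) * (k * (3 * Lg / α * (1 + Real.log T)))
      ≤ 6 * (Lg / α * ((β * G + Lf) * k) * (1 + Real.log T)) := by
    calc _ = 3 * (Lg / α * ((β * G + 2 * Lf) * k) * (1 + Real.log T)) := by ring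
      _ ≤ 3 * (Lg / α * ((2 * (β * G + Lf)) * k) * (1 + Real.log T)) := by
        gcongr; nlinarith [mul_nonneg hβ hG0]
      _ = _ := by ring
  have r5 : α * G ^ 2 * τ ≥ α * G ^ 2 * 1 := by gcongr
  have n1 : 0 ≤ Lg / α * (Lg * τ) * (1 + Real.log T) := by positivity
  have n2 : 0 ≤ Lg / α * (Lc * h ^ 2) * (1 + Real.log T) := by positivity
  have n3 : 0 ≤ α * G ^ 2 * k := by positivity
  have n4 : 0 ≤ α * G ^ 2 * τ := by positivity
  have e : Lg / α * (Lg * τ + (β * G + Lf) * k + Lc * h ^ 2) * (1 + Real.log T)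
      = Lg / α * (Lg * τ) * (1 + Real.log T) + Lg / α * ((β * G + Lf) * k) * (1 + Real.log T)
        + Lg / α * (Lc * h ^ 2) * (1 + Real.log T) := by ring
  rw [e]
  -- The coefficients of the squared distances add up: `-3/8 + 1/8 + 1/6 = -1/12`.
  linarith

/-! ### Strong convexity defects of a single function. -/

/-- The defect of `α`-strong convexity of `f` on the segment from `c` to `a`. -/
noncomputable def convexDefect {d : ℕ} (α s : ℝ) (f : EuclideanSpace ℝ (Fin d) → ℝ)
    (a c : EuclideanSpace ℝ (Fin d)) : ℝ :=
  f (c + s • (a - c)) - ((1 - s) * f c + s * f a) + α / 2 * (s * (1 - s)) * ‖c - a‖ ^ 2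

/-- The defect of the first-order `α`-strong convexity inequality at `c`, for a candidate
gradient `v`. -/
noncomputable def gradDefect {d : ℕ} (α : ℝ) (f : EuclideanSpace ℝ (Fin d) → ℝ)
    (a c v : EuclideanSpace ℝ (Fin d)) : ℝ :=
  f c - f a - inner ℝ v (c - a) + α * ‖c - a‖ ^ 2

section Deterministic

variable {d : ℕ} {W : Set (EuclideanSpace ℝ (Fin d))} {α L G s : ℝ}
  {f : EuclideanSpace ℝ (Fin d) → ℝ} {a c v : EuclideanSpace ℝ (Fin d)}

/-- The factor `s` matters: it keeps `convexDefect / s` bounded as `s` tends to `0`, which is the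
domination needed for the first-order limit. -/
lemma abs_convexDefect_le (hW : Convex ℝ W) (hα : 0 ≤ α) (hL : 0 ≤ L) (hs : s ∈ Set.Icc (0 : ℝ) 1)
    (hf : ∀ x ∈ W, ∀ y ∈ W, |f x - f y| ≤ L * ‖x - y‖) (hG : ∀ x ∈ W, ∀ y ∈ W, ‖x - y‖ ≤ G)
    (ha : a ∈ W) (hc : c ∈ W) :
    |convexDefect α s f a c| ≤ s * (2 * (L * G) + α * G ^ 2) := by
  have hq := hW.add_smul_sub_mem hc ha hs
  have h1 := hf _ hq _ hc
  rw [add_sub_cancel_left, norm_smul, Real.norm_of_nonneg hs.1] at h1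
  have h2 := hf _ hc _ ha
  have h3 := hG _ ha _ hc
  have h4 := hG _ hc _ ha
  have h5 : L * (s * ‖a - c‖) ≤ s * (L * G) := by
    rw [mul_left_comm]; have := hs.1; gcongr
  have h6 : s * |f c - f a| ≤ s * (L * G) :=
    mul_le_mul_of_nonneg_left (h2.trans (by gcongr)) hs.1
  have h7 : α / 2 * (s * (1 - s)) * ‖c - a‖ ^ 2 ≤ s * (α * G ^ 2) := by
    have h8 : ‖c - a‖ ^ 2 ≤ G ^ 2 := by gcongr
    have h9 : 0 ≤ α * s * ‖c - a‖ ^ 2 := mul_nonneg (mul_nonneg hα hs.1) (sq_nonneg _)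
    have h10 : α * s * ‖c - a‖ ^ 2 ≤ α * s * G ^ 2 :=
      mul_le_mul_of_nonneg_left h8 (mul_nonneg hα hs.1)
    nlinarith [hs.1, hs.2, mul_nonneg hs.1 h9]
  have h8 : 0 ≤ α / 2 * (s * (1 - s)) * ‖c - a‖ ^ 2 :=
    mul_nonneg (mul_nonneg (by linarith) (mul_nonneg hs.1 (by linarith [hs.2]))) (sq_nonneg _)
  have e : convexDefect α s f a c = (f (c + s • (a - c)) - f c) + s * (f c - f a)
      + α / 2 * (s * (1 - s)) * ‖c - a‖ ^ 2 := by unfold convexDefect; ring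
  rw [e]
  refine (abs_add_three _ _ _).trans ?_
  rw [abs_mul, abs_of_nonneg hs.1, abs_of_nonneg h8]
  linarith

lemma continuousOn_of_abs_sub_le (hf : ∀ x ∈ W, ∀ y ∈ W, |f x - f y| ≤ L * ‖x - y‖) :
    ContinuousOn f W := by
  have : LipschitzOnWith (Real.toNNReal L) f W := LipschitzOnWith.of_dist_le_mul fun x hx y hy => by
    rw [Real.dist_eq, dist_eq_norm]
    exact (hf x hx y hy).trans (by gcongr; exact Real.le_coe_toNNReal L)
  exact this.continuousOn

lemma continuousOn_convexDefect (hW : Convex ℝ W) (hs : s ∈ Set.Icc (0 : ℝ) 1)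
    (hf : ∀ x ∈ W, ∀ y ∈ W, |f x - f y| ≤ L * ‖x - y‖) (ha : a ∈ W) :
    ContinuousOn (convexDefect α s f a) W := by
  have hc := continuousOn_of_abs_sub_le hf
  have h1 : ContinuousOn (fun c => f (c + s • (a - c))) W :=
    hc.comp (by fun_prop) fun c hc => hW.add_smul_sub_mem hc ha hs
  exact (h1.sub ((continuousOn_const.mul hc).add continuousOn_const)).add (by fun_prop)

lemma tendsto_convexDefect (hW : Convex ℝ W) (ha : a ∈ W) (hc : c ∈ W)
    (hf : HasGradientWithinAt f v W c) :
    Filter.Tendsto (fun n : ℕ => ((n : ℝ) + 1) * convexDefect α ((n : ℝ) + 1)⁻¹ f a c)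
      Filter.atTop (nhds (gradDefect (α / 2) f a c v)) := by
  have h0 : Filter.Tendsto (fun n : ℕ => ((n : ℝ) + 1)⁻¹) Filter.atTop (nhds 0) := by
    simpa using tendsto_one_div_add_atTop_nhds_zero_nat (𝕜 := ℝ)
  have h := ((tendsto_slope_of_hasGradientWithinAt hW hc ha hf).add
    (tendsto_const_nhds (x := f c - f a))).add
    (((h0.const_sub 1).const_mul (α / 2)).mul_const (‖c - a‖ ^ 2))
  have e : gradDefect (α / 2) f a c v
      = inner ℝ v (a - c) + (f c - f a) + α / 2 * (1 - 0) * ‖c - a‖ ^ 2 := by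
    unfold gradDefect
    rw [← neg_sub c a, inner_neg_right]
    ring
  rw [e]
  refine h.congr fun n => ?_
  have : ((n : ℝ) + 1) ≠ 0 := by positivity
  unfold convexDefect
  field_simp
  ring

end Deterministic

/-! ### Conditional strong convexity at random points. -/

section Stochastic

variable {Ω : Type*} {m m₀ : MeasurableSpace Ω} {μ : Measure Ω} [IsProbabilityMeasure μ]
  {d : ℕ} {W : Set (EuclideanSpace ℝ (Fin d))} {α L G s : ℝ}
  {f : Ω → EuclideanSpace ℝ (Fin d) → ℝ}

/-- The weight comes out of the conditional expectation, and the conditional mean of the defect is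
the defect of the strongly convex version. Only three fixed points of `W` occur, so their null sets
cause no trouble. Testing against weights gives a form that passes to limits in the point. -/
lemma integral_mul_convexDefect_const_le (hm : m ≤ m₀) (hs : s ∈ Set.Icc (0 : ℝ) 1)
    (hconv : CondStronglyConvex μ m W α f) (hint : ∀ x ∈ W, Integrable (fun ω => f ω x) μ)
    {a c : EuclideanSpace ℝ (Fin d)} (ha : a ∈ W) (hc : c ∈ W) {w : Ω → ℝ} {B : ℝ}
    (hw : StronglyMeasurable[m] w) (hw0 : ∀ ω, 0 ≤ w ω) (hwB : ∀ ω, w ω ≤ B) :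
    ∫ ω, w ω * convexDefect α s (f ω) a c ∂μ ≤ 0 := by
  obtain ⟨fc, hfc, hsc⟩ := hconv
  obtain ⟨ω₀, hω₀⟩ := hsc.exists
  have hW : Convex ℝ W := hω₀.1
  have hq := hW.add_smul_sub_mem hc ha hs
  have i1 := hint _ hq
  have i2 := (hint _ hc).const_mul (1 - s)
  have i3 := (hint _ ha).const_mul s
  set K := α / 2 * (s * (1 - s)) * ‖c - a‖ ^ 2 with hK
  have i4 : Integrable (fun _ : Ω => K) μ := integrable_const _
  have hi : Integrable (fun ω => convexDefect α s (f ω) a c) μ := (i1.sub (i2.add i3)).add i4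
  have hce : μ[fun ω => convexDefect α s (f ω) a c | m] ≤ᵐ[μ] 0 := by
    have e1 := condExp_add (m := m) (i1.sub (i2.add i3)) i4
    have e2 := condExp_sub (m := m) i1 (i2.add i3)
    have e3 := condExp_add (m := m) i2 i3
    have e4 := condExp_smul (μ := μ) (1 - s) (fun ω => f ω c) m
    have e5 := condExp_smul (μ := μ) s (fun ω => f ω a) m
    have e6 := condExp_const (μ := μ) hm K
    filter_upwards [e1, e2, e3, e4, e5, hfc _ hq, hfc _ hc, hfc _ ha, hsc]
      with ω e1 e2 e3 e4 e5 g1 g2 g3 hω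
    have h := hω.2 hc ha (sub_nonneg.2 hs.2) hs.1 (sub_add_cancel 1 s)
    have hpt : (1 - s) • c + s • a = c + s • (a - c) := by module
    rw [hpt] at h
    change μ[(fun ω => f ω (c + s • (a - c))) - ((fun ω => (1 - s) * f ω c)
      + fun ω => s * f ω a) + fun _ => K | m] ω ≤ 0
    change μ[fun ω => (1 - s) * f ω c | m] ω = _ at e4
    change μ[fun ω => s * f ω a | m] ω = _ at e5
    rw [e1, Pi.add_apply, e2, Pi.sub_apply, e3, Pi.add_apply, e4, e5, e6]
    simp only [Pi.smul_apply, smul_eq_mul] at h ⊢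
    rw [← g1, ← g2, ← g3]
    linarith
  have hb : ∀ᵐ ω ∂μ, ‖w ω‖ ≤ B :=
    Filter.Eventually.of_forall fun ω => by rw [Real.norm_of_nonneg (hw0 ω)]; exact hwB ω
  have hmul := condExp_stronglyMeasurable_mul_of_bound hm hw hi B hb
  have e := integral_condExp (μ := μ) (f := w * fun ω => convexDefect α s (f ω) a c) hm
  change ∫ ω, (w * fun ω => convexDefect α s (f ω) a c) ω ∂μ ≤ 0
  rw [← e, integral_congr_ae hmul]
  refine integral_nonpos_of_ae ?_
  filter_upwards [hce] with ω hω
  exact mul_nonpos_of_nonneg_of_nonpos (hw0 ω) hω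

/-- Evaluating a random continuous function at a random point is measurable. -/
lemma stronglyMeasurable_eval {m : MeasurableSpace Ω} {u : Ω → EuclideanSpace ℝ (Fin d) → ℝ}
    (hu : ∀ c ∈ W, StronglyMeasurable fun ω => u ω c) (huc : ∀ ω, ContinuousOn (u ω) W)
    {y : Ω → EuclideanSpace ℝ (Fin d)} (hy : StronglyMeasurable y) (hyW : ∀ ω, y ω ∈ W) :
    StronglyMeasurable fun ω => u ω (y ω) := by
  have h := stronglyMeasurable_uncurry_of_continuous_of_stronglyMeasurable
    (u := fun (c : W) ω => u ω c) (fun ω => (huc ω).domRestrict) fun c => hu c c.2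
  exact h.comp_measurable
    (g := fun ω => ((⟨y ω, hyW ω⟩ : W), ω)) ((hy.measurable.subtype_mk).prodMk measurable_id)

lemma stronglyMeasurable_convexDefect {m : MeasurableSpace Ω} (hW : Convex ℝ W)
    (hs : s ∈ Set.Icc (0 : ℝ) 1) (hf : ∀ x ∈ W, StronglyMeasurable fun ω => f ω x)
    (hlip : ∀ ω, ∀ x ∈ W, ∀ y ∈ W, |f ω x - f ω y| ≤ L * ‖x - y‖)
    {a : EuclideanSpace ℝ (Fin d)} (ha : a ∈ W) {y : Ω → EuclideanSpace ℝ (Fin d)}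
    (hy : StronglyMeasurable y) (hyW : ∀ ω, y ω ∈ W) :
    StronglyMeasurable fun ω => convexDefect α s (f ω) a (y ω) := by
  refine stronglyMeasurable_eval (W := W) (fun c hc => ?_)
    (fun ω => continuousOn_convexDefect hW hs (hlip ω) ha) hy hyW
  exact ((hf _ (hW.add_smul_sub_mem hc ha hs)).sub
    (((hf c hc).const_mul _).add ((hf a ha).const_mul _))).add stronglyMeasurable_const

/-- On each fibre of `y` the point is constant, and the indicator of the fibre is absorbed into the
weight. -/
lemma integral_mul_convexDefect_simpleFunc_le (hm : m ≤ m₀) (hs : s ∈ Set.Icc (0 : ℝ) 1)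
    (hconv : CondStronglyConvex μ m W α f) (hint : ∀ x ∈ W, Integrable (fun ω => f ω x) μ)
    {a : EuclideanSpace ℝ (Fin d)} (ha : a ∈ W) (y : @SimpleFunc Ω m W) {w : Ω → ℝ} {B : ℝ}
    (hw : StronglyMeasurable[m] w) (hw0 : ∀ ω, 0 ≤ w ω) (hwB : ∀ ω, w ω ≤ B) :
    ∫ ω, w ω * convexDefect α s (f ω) a (y ω) ∂μ ≤ 0 := by
  classical
  obtain ⟨ω₀, hω₀⟩ := hconv.choose_spec.2.exists
  have hW : Convex ℝ W := hω₀.1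
  have e : ∀ ω, w ω * convexDefect α s (f ω) a (y ω)
      = ∑ c ∈ @SimpleFunc.range _ _ m y, (y ⁻¹' {c}).indicator w ω * convexDefect α s (f ω) a c := by
    intro ω
    rw [Finset.sum_eq_single (y ω)]
    · simp
    · intro c _ hc
      rw [Set.indicator_of_notMem (by simpa using hc.symm), zero_mul]
    · intro h; exact absurd (@SimpleFunc.mem_range_self _ _ m y ω) h
  simp_rw [e]
  have hind : ∀ c, StronglyMeasurable[m] ((y ⁻¹' {c}).indicator w) := fun c =>
    hw.indicator (@SimpleFunc.measurableSet_fiber _ _ m y c)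
  have hind0 : ∀ c ω, 0 ≤ (y ⁻¹' {c}).indicator w ω := fun c ω =>
    Set.indicator_nonneg (fun ω _ => hw0 ω) ω
  have hindB : ∀ c ω, (y ⁻¹' {c}).indicator w ω ≤ B := fun c ω =>
    (Set.indicator_le_self' (fun ω _ => hw0 ω) ω).trans (hwB ω)
  rw [integral_finsetSum]
  · exact Finset.sum_nonpos fun c _ => integral_mul_convexDefect_const_le hm hs hconv hint ha c.2
      (hind c) (hind0 c) (hindB c)
  · intro c _
    have hi : Integrable (fun ω => convexDefect α s (f ω) a c) μ :=
      ((hint _ (hW.add_smul_sub_mem c.2 ha hs)).sub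
        (((hint _ c.2).const_mul _).add ((hint _ ha).const_mul _))).add (integrable_const _)
    refine hi.bdd_mul (c := B) ((hind c).mono hm).aestronglyMeasurable
      (Filter.Eventually.of_forall fun ω => ?_)
    rw [Real.norm_of_nonneg (hind0 c ω)]; exact hindB c ω

/-- Approximate `y` by simple functions with values in `W`; the defect is continuous in the point
and uniformly bounded, so dominated convergence applies. -/
lemma integral_mul_convexDefect_le (hm : m ≤ m₀) (hα : 0 ≤ α) (hL : 0 ≤ L)
    (hs : s ∈ Set.Icc (0 : ℝ) 1)
    (hconv : CondStronglyConvex μ m W α f) (hint : ∀ x ∈ W, Integrable (fun ω => f ω x) μ)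
    (hmeas : ∀ x ∈ W, StronglyMeasurable fun ω => f ω x)
    (hlip : ∀ ω, ∀ x ∈ W, ∀ y ∈ W, |f ω x - f ω y| ≤ L * ‖x - y‖)
    (hG : ∀ x ∈ W, ∀ y ∈ W, ‖x - y‖ ≤ G)
    {a : EuclideanSpace ℝ (Fin d)} (ha : a ∈ W) {y : Ω → EuclideanSpace ℝ (Fin d)}
    (hy : StronglyMeasurable[m] y) (hyW : ∀ ω, y ω ∈ W) {w : Ω → ℝ} {B : ℝ}
    (hw : StronglyMeasurable[m] w) (hw0 : ∀ ω, 0 ≤ w ω) (hwB : ∀ ω, w ω ≤ B) :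
    ∫ ω, w ω * convexDefect α s (f ω) a (y ω) ∂μ ≤ 0 := by
  obtain ⟨ω₀, hω₀⟩ := hconv.choose_spec.2.exists
  have hW : Convex ℝ W := hω₀.1
  have hyW' : StronglyMeasurable[m] (fun ω => (⟨y ω, hyW ω⟩ : W)) :=
    Measurable.stronglyMeasurable (hy.measurable.subtype_mk)
  let yn : ℕ → @SimpleFunc Ω m W := fun n => hyW'.approx n
  have hyn : ∀ n, StronglyMeasurable fun ω => (yn n ω : EuclideanSpace ℝ (Fin d)) := fun n =>
    (continuous_subtype_val.comp_stronglyMeasurable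
      ((@SimpleFunc.stronglyMeasurable _ _ m _ (yn n)).mono hm))
  refine le_of_tendsto_of_frequently (tendsto_integral_of_dominated_convergence (μ := μ)
    (F := fun n ω => w ω * convexDefect α s (f ω) a (yn n ω))
    (fun _ => B * (s * (2 * (L * G) + α * G ^ 2))) (fun n => ?_) (integrable_const _)
    (fun n => Filter.Eventually.of_forall fun ω => ?_)
    (Filter.Eventually.of_forall fun ω => ?_)) (Filter.Frequently.of_forall fun n => ?_)
  · exact ((hw.mono hm).mul (stronglyMeasurable_convexDefect hW hs hmeas hlip ha (hyn n)
      fun ω => (yn n ω).2)).aestronglyMeasurable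
  · rw [norm_mul, Real.norm_of_nonneg (hw0 ω)]
    exact mul_le_mul (hwB ω) (abs_convexDefect_le hW hα hL hs (hlip ω) hG ha (yn n ω).2)
      (norm_nonneg _) ((hw0 ω).trans (hwB ω))
  · refine Filter.Tendsto.const_mul _ ?_
    have h1 : Filter.Tendsto (fun n => yn n ω) Filter.atTop (nhds (⟨y ω, hyW ω⟩ : W)) :=
      hyW'.tendsto_approx ω
    have h2 := (continuousOn_convexDefect (α := α) hW hs (hlip ω) ha).domRestrict.tendsto
      (⟨y ω, hyW ω⟩ : W)
    exact h2.comp h1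
  · exact integral_mul_convexDefect_simpleFunc_le hm hs hconv hint ha (yn n) hw hw0 hwB

variable {v : Ω → EuclideanSpace ℝ (Fin d)}

lemma inv_add_one_mem_Icc (n : ℕ) : ((n : ℝ) + 1)⁻¹ ∈ Set.Icc (0 : ℝ) 1 :=
  ⟨by positivity, inv_le_one_of_one_le₀ (by linarith [n.cast_nonneg (α := ℝ)])⟩

/-- Nothing is known about the measurability of `v`; the defect is measurable as a pointwise limit
of rescaled convexity defects, whose coefficient halves in the limit. -/
lemma stronglyMeasurable_gradDefect {m : MeasurableSpace Ω} (hW : Convex ℝ W)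
    (hf : ∀ x ∈ W, StronglyMeasurable fun ω => f ω x)
    (hlip : ∀ ω, ∀ x ∈ W, ∀ y ∈ W, |f ω x - f ω y| ≤ L * ‖x - y‖)
    {a : EuclideanSpace ℝ (Fin d)} (ha : a ∈ W) {y : Ω → EuclideanSpace ℝ (Fin d)}
    (hy : StronglyMeasurable y) (hyW : ∀ ω, y ω ∈ W)
    (hv : ∀ ω, HasGradientWithinAt (f ω) (v ω) W (y ω)) :
    StronglyMeasurable fun ω => gradDefect α (f ω) a (y ω) (v ω) := by
  have h2 : α = 2 * α / 2 := by ring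
  refine stronglyMeasurable_of_tendsto Filter.atTop (f := fun (n : ℕ) ω =>
    ((n : ℝ) + 1) * convexDefect (2 * α) ((n : ℝ) + 1)⁻¹ (f ω) a (y ω)) (fun n => ?_)
    (tendsto_pi_nhds.2 fun ω => ?_)
  · exact (stronglyMeasurable_convexDefect hW (inv_add_one_mem_Icc n) hf hlip ha hy
      hyW).const_mul _
  · rw [h2]; simpa using tendsto_convexDefect hW ha (hyW ω) (hv ω) (α := 2 * α)

/-- Conditional strong convexity, in first-order form, at a random point. -/
lemma integral_mul_gradDefect_le (hm : m ≤ m₀) (hα : 0 ≤ α) (hL : 0 ≤ L)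
    (hconv : CondStronglyConvex μ m W α f) (hint : ∀ x ∈ W, Integrable (fun ω => f ω x) μ)
    (hmeas : ∀ x ∈ W, StronglyMeasurable fun ω => f ω x)
    (hlip : ∀ ω, ∀ x ∈ W, ∀ y ∈ W, |f ω x - f ω y| ≤ L * ‖x - y‖)
    (hG : ∀ x ∈ W, ∀ y ∈ W, ‖x - y‖ ≤ G)
    {a : EuclideanSpace ℝ (Fin d)} (ha : a ∈ W) {y : Ω → EuclideanSpace ℝ (Fin d)}
    (hy : StronglyMeasurable[m] y) (hyW : ∀ ω, y ω ∈ W)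
    (hv : ∀ ω, HasGradientWithinAt (f ω) (v ω) W (y ω)) {w : Ω → ℝ} {B : ℝ}
    (hw : StronglyMeasurable[m] w) (hw0 : ∀ ω, 0 ≤ w ω) (hwB : ∀ ω, w ω ≤ B) :
    ∫ ω, w ω * gradDefect (α / 2) (f ω) a (y ω) (v ω) ∂μ ≤ 0 := by
  obtain ⟨ω₀, hω₀⟩ := hconv.choose_spec.2.exists
  have hW : Convex ℝ W := hω₀.1
  refine le_of_tendsto_of_frequently (tendsto_integral_of_dominated_convergence (μ := μ)
    (F := fun (n : ℕ) ω => w ω * (((n : ℝ) + 1) * convexDefect α ((n : ℝ) + 1)⁻¹ (f ω) a (y ω)))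
    (fun _ => B * (2 * (L * G) + α * G ^ 2)) (fun n => ?_) (integrable_const _)
    (fun n => Filter.Eventually.of_forall fun ω => ?_)
    (Filter.Eventually.of_forall fun ω => ?_)) (Filter.Frequently.of_forall fun n => ?_)
  · exact ((hw.mono hm).mul ((stronglyMeasurable_convexDefect hW (inv_add_one_mem_Icc n) hmeas hlip
      ha (hy.mono hm) hyW).const_mul _)).aestronglyMeasurable
  · rw [norm_mul, Real.norm_of_nonneg (hw0 ω)]
    refine mul_le_mul (hwB ω) ?_ (norm_nonneg _) ((hw0 ω).trans (hwB ω))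
    have hn : (0 : ℝ) < (n : ℝ) + 1 := by positivity
    have h := abs_convexDefect_le hW hα hL (inv_add_one_mem_Icc n) (hlip ω) hG ha (hyW ω)
    rw [norm_mul, Real.norm_of_nonneg hn.le, Real.norm_eq_abs]
    calc _ ≤ _ := mul_le_mul_of_nonneg_left h hn.le
      _ = _ := by rw [mul_inv_cancel_left₀ hn.ne']
  · exact (tendsto_convexDefect hW ha (hyW ω) (hv ω)).const_mul _
  · have h := integral_mul_convexDefect_le hm hα hL (inv_add_one_mem_Icc n) hconv hint hmeas hlip
      hG ha hy hyW hw hw0 hwB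
    simp_rw [mul_left_comm (w _)]
    rw [integral_const_mul]
    exact mul_nonpos_of_nonneg_of_nonpos (by positivity) h

end Stochastic

/-! ### A finite net of comparators. -/

section Net

/-- A finite net of a bounded subset of a Euclidean space, obtained from a cubic grid. -/
lemma exists_grid_net {d : ℕ} {W : Set (EuclideanSpace ℝ (Fin d))}
    {x₀ : EuclideanSpace ℝ (Fin d)} (hx₀ : x₀ ∈ W) {D : ℝ} (hD0 : 0 < D)
    (hD : ∀ x ∈ W, ‖x - x₀‖ ≤ D) {n : ℕ} (hn : 0 < n) :
    ∃ p : (Fin d → Fin (2 * n + 1)) → EuclideanSpace ℝ (Fin d), (∀ c, p c ∈ W) ∧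
      ∀ x ∈ W, ∃ c, ‖x - p c‖ ≤ √d * (D / n) := by
  classical
  have hn0 : (0 : ℝ) < n := by exact_mod_cast hn
  -- Coordinates are rescaled to `[0, 2 * n]`, so unit cells have side `D / n`. Reduction modulo `2
  -- * n + 1` in `Fin.ofNat` then changes nothing on `W`.
  let u : EuclideanSpace ℝ (Fin d) → Fin d → ℝ := fun x i => (x i - x₀ i) * (n / D) + n
  let cell : EuclideanSpace ℝ (Fin d) → Fin d → Fin (2 * n + 1) :=
    fun x i => Fin.ofNat (2 * n + 1) ⌊u x i⌋₊
  have hu : ∀ x ∈ W, ∀ i, 0 ≤ u x i ∧ u x i ≤ 2 * n := by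
    intro x hx i
    have h1 : |x i - x₀ i| ≤ D := by
      simpa using (PiLp.norm_apply_le (x - x₀) i).trans (hD x hx)
    rw [abs_le] at h1
    have h2 : D * (n / D) = n := by field_simp
    have h3 : 0 ≤ (n : ℝ) / D := by positivity
    constructor <;> simp only [u] <;> nlinarith
  have hcell : ∀ x ∈ W, ∀ i, (cell x i : ℕ) = ⌊u x i⌋₊ := by
    intro x hx i
    have h : ⌊u x i⌋₊ ≤ 2 * n := Nat.floor_le_of_le (by exact_mod_cast (hu x hx i).2)
    simp only [cell, Fin.val_ofNat]
    exact Nat.mod_eq_of_lt (by omega)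
  refine ⟨fun c => if h : ∃ x ∈ W, cell x = c then h.choose else x₀, fun c => ?_, fun x hx => ?_⟩
  · beta_reduce
    split_ifs with h
    · exact h.choose_spec.1
    · exact hx₀
  · have h : ∃ y ∈ W, cell y = cell x := ⟨x, hx, rfl⟩
    refine ⟨cell x, ?_⟩
    simp only [dif_pos h]
    obtain ⟨hy, hyx⟩ := h.choose_spec
    generalize h.choose = y at hy hyx
    have hcoord : ∀ i, ‖(x - y) i‖ ^ 2 ≤ (D / n) ^ 2 := by
      intro i
      have h1 : ⌊u y i⌋₊ = ⌊u x i⌋₊ := by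
        rw [← hcell x hx, ← hcell y hy, hyx]
      have h2 : |u x i - u y i| ≤ 1 := by
        have a1 := Nat.floor_le (hu x hx i).1
        have a2 := Nat.floor_le (hu y hy i).1
        have a3 := Nat.lt_floor_add_one (u x i)
        have a4 := Nat.lt_floor_add_one (u y i)
        rw [h1] at a2 a4
        rw [abs_le]; constructor <;> linarith
      have h3 : u x i - u y i = (x i - y i) * (n / D) := by simp only [u]; ring
      rw [h3, abs_mul, abs_of_pos (show 0 < (n : ℝ) / D by positivity)] at h2
      have h4 : ‖(x - y) i‖ ≤ D / n := by
        rw [PiLp.sub_apply, Real.norm_eq_abs]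
        calc _ = |x i - y i| * (n / D) * (D / n) := by field_simp
          _ ≤ 1 * (D / n) := by gcongr
          _ = _ := one_mul _
      gcongr
    rw [EuclideanSpace.norm_eq]
    calc _ ≤ √(∑ _i : Fin d, (D / n) ^ 2) :=
          Real.sqrt_le_sqrt (Finset.sum_le_sum fun i _ => hcoord i)
      _ = _ := by
          rw [Finset.sum_const, Finset.card_univ, Fintype.card_fin, nsmul_eq_mul,
            Real.sqrt_mul (by positivity), Real.sqrt_sq (by positivity)]

end Net

/-! ### Exponential moments and concentration. -/

section Concentration

variable {Ω : Type*} {m m₀ : MeasurableSpace Ω} {μ : Measure Ω} [IsProbabilityMeasure μ]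

/-- An exponential supermartingale bound for increments that are controlled conditionally on the
past up to a lag `k`, along one residue class modulo `k`. -/
lemma integral_exp_sum_le_one {ℱ : Filtration ℕ m₀} {k T : ℕ} {Z : ℕ → Ω → ℝ} {K : ℝ}
    (hmeas : ∀ t, k ≤ t → t < T → StronglyMeasurable[ℱ t] (Z t))
    (hbdd : ∀ t, k ≤ t → t < T → ∀ ω, Z t ω ≤ K)
    (hsuper : ∀ t, k ≤ t → t < T → ∀ (V : Ω → ℝ) (B : ℝ), StronglyMeasurable[ℱ (t - k)] V →
      (∀ ω, 0 ≤ V ω) → (∀ ω, V ω ≤ B) → ∫ ω, V ω * Real.exp (Z t ω) ∂μ ≤ ∫ ω, V ω ∂μ)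
    (r : ℕ) {N : ℕ} (hN : N ≤ T) :
    ∫ ω, Real.exp (∑ t ∈ Finset.Ico k N with t % k = r, Z t ω) ∂μ ≤ 1 := by
  induction N with
  | zero => simp
  | succ N ih =>
    have ih := ih (by omega)
    by_cases hkN : k ≤ N
    · rw [← Finset.insert_Ico_right_eq_Ico_add_one hkN, Finset.filter_insert]
      split_ifs with hr
      · have hnot : N ∉ (Finset.Ico k N).filter (fun t => t % k = r) := by simp
        have e : ∀ ω, Real.exp (∑ t ∈ insert N ((Finset.Ico k N).filter fun t => t % k = r), Z t ω)
            = Real.exp (∑ t ∈ Finset.Ico k N with t % k = r, Z t ω) * Real.exp (Z N ω) := by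
          intro ω
          rw [Finset.sum_insert hnot, Real.exp_add, mul_comm]
        simp_rw [e]
        refine le_trans (hsuper N hkN (by omega) _
          (Real.exp (∑ t ∈ Finset.Ico k N with t % k = r, K)) ?_ (fun ω => (Real.exp_pos _).le)
          fun ω => ?_) ih
        · refine Real.continuous_exp.comp_stronglyMeasurable
            (Finset.stronglyMeasurable_fun_sum _ fun t ht => ?_)
          rw [Finset.mem_filter, Finset.mem_Ico] at ht
          obtain ⟨⟨h1, h2⟩, h3⟩ := ht
          -- Distinct indices of one residue class are at least `k` apart, so the product of the
          -- earlier exponentials is `ℱ (N - k)`-measurable and may serve as the weight `V`.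
          have h4 : t + k ≤ N := by
            have h5 : t ≡ N [MOD k] := h3.trans hr.symm
            have h6 := (Nat.modEq_iff_dvd' h2.le).1 h5
            have := Nat.le_of_dvd (by omega) h6
            omega
          exact (hmeas t h1 (by omega)).mono (ℱ.mono (by omega))
        · refine Real.exp_le_exp.2 (Finset.sum_le_sum fun t ht => ?_)
          rw [Finset.mem_filter, Finset.mem_Ico] at ht
          exact hbdd t ht.1.1 (by omega) ω
      · exact ih
    · rw [Finset.Ico_eq_empty (by omega)]; simp

/-- Markov's inequality and a union bound over residue classes and over a finite family. -/
lemma exists_event_sum_le {ι : Type*} [Fintype ι] [Nonempty ι] {k T : ℕ} (hk : 0 < k)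
    {Z : ι → ℕ → Ω → ℝ} {K : ℝ}
    (hmeas : ∀ i, ∀ t, k ≤ t → t < T → StronglyMeasurable (Z i t))
    (hbdd : ∀ i, ∀ t, k ≤ t → t < T → ∀ ω, Z i t ω ≤ K)
    (hexp : ∀ i r, ∫ ω, Real.exp (∑ t ∈ Finset.Ico k T with t % k = r, Z i t ω) ∂μ ≤ 1)
    {δ : ℝ} (hδ : 0 < δ) :
    ∃ A : Set Ω, MeasurableSet A ∧ ENNReal.ofReal (1 - δ) ≤ μ A ∧ ∀ ω ∈ A, ∀ i,
      ∑ t ∈ Finset.Ico k T, Z i t ω ≤ k * Real.log (k * Fintype.card ι / δ) := by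
  have hk0 : (0 : ℝ) < k := by exact_mod_cast hk
  have hc0 : (0 : ℝ) < Fintype.card ι := by exact_mod_cast Fintype.card_pos
  -- Each of the `k * card ι` bad events has probability at most `1 / M`, and these bounds sum to
  -- `δ`.
  set M : ℝ := k * Fintype.card ι / δ with hM
  have hM0 : 0 < M := by positivity
  let S : ι → ℕ → Ω → ℝ := fun i r ω => ∑ t ∈ Finset.Ico k T with t % k = r, Z i t ω
  have hS : ∀ i r, StronglyMeasurable (S i r) := fun i r =>
    Finset.stronglyMeasurable_fun_sum _ fun t ht => by
      rw [Finset.mem_filter, Finset.mem_Ico] at ht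
      exact hmeas i t ht.1.1 ht.1.2
  let bad : ι × ℕ → Set Ω := fun q => {ω | M ≤ Real.exp (S q.1 q.2 ω)}
  have hbad : ∀ q, MeasurableSet (bad q) := fun q =>
    measurableSet_le measurable_const (Real.measurable_exp.comp (hS q.1 q.2).measurable)
  have hprob : ∀ q, μ.real (bad q) ≤ 1 / M := by
    intro q
    have hint : Integrable (fun ω => Real.exp (S q.1 q.2 ω)) μ := by
      refine Integrable.of_bound
        (Real.continuous_exp.comp_stronglyMeasurable (hS q.1 q.2)).aestronglyMeasurable
        (Real.exp (∑ t ∈ Finset.Ico k T with t % k = q.2, K))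
        (Filter.Eventually.of_forall fun ω => ?_)
      rw [Real.norm_of_nonneg (Real.exp_pos _).le]
      refine Real.exp_le_exp.2 (Finset.sum_le_sum fun t ht => ?_)
      rw [Finset.mem_filter, Finset.mem_Ico] at ht
      exact hbdd _ t ht.1.1 ht.1.2 ω
    have h := mul_meas_ge_le_integral_of_nonneg
      (Filter.Eventually.of_forall fun ω => (Real.exp_pos _).le) hint M
    rw [le_div_iff₀' hM0]
    exact h.trans (hexp q.1 q.2)
  set Q : Finset (ι × ℕ) := Finset.univ ×ˢ Finset.range k with hQ
  have hU : MeasurableSet (⋃ q ∈ Q, bad q) := Finset.measurableSet_biUnion _ fun q _ => hbad q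
  refine ⟨(⋃ q ∈ Q, bad q)ᶜ, hU.compl, ?_, fun ω hω i => ?_⟩
  · have h1 : μ.real (⋃ q ∈ Q, bad q) ≤ δ := by
      calc _ ≤ ∑ q ∈ Q, μ.real (bad q) := measureReal_biUnion_finset_le _ _
        _ ≤ ∑ q ∈ Q, 1 / M := Finset.sum_le_sum fun q _ => hprob q
        _ = δ := by
          rw [Finset.sum_const, hQ, Finset.card_product, Finset.card_univ, Finset.card_range,
            nsmul_eq_mul, hM]
          push_cast
          field_simp
    have h2 := probReal_compl_eq_one_sub (μ := μ) hU
    rw [← ofReal_measureReal]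
    exact ENNReal.ofReal_le_ofReal (by linarith)
  · have h1 : ∀ r < k, S i r ω ≤ Real.log M := by
      intro r hr
      by_contra hlt
      push Not at hlt
      refine hω (Set.mem_biUnion (x := (i, r)) (by simp [hQ, hr]) ?_)
      change M ≤ Real.exp (S i r ω)
      rw [← Real.exp_log hM0]
      exact Real.exp_le_exp.2 hlt.le
    rw [← Finset.sum_fiberwise_of_maps_to (g := fun t => t % k) (t := Finset.range k)
      fun t _ => Finset.mem_range.2 (Nat.mod_lt _ hk)]
    calc _ ≤ ∑ r ∈ Finset.range k, Real.log M :=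
          Finset.sum_le_sum fun r hr => h1 r (Finset.mem_range.1 hr)
      _ = _ := by simp

variable {d : ℕ} {W : Set (EuclideanSpace ℝ (Fin d))} {α L : ℝ}
  {f : Ω → EuclideanSpace ℝ (Fin d) → ℝ}

/-- A set that carries a conditionally strongly convex, Lipschitz random function is bounded. -/
lemma CondStronglyConvex.norm_sub_le (hm : m ≤ m₀) (hα : 0 < α) (hL : 0 ≤ L)
    (hconv : CondStronglyConvex μ m W α f) (hint : ∀ x ∈ W, Integrable (fun ω => f ω x) μ)
    (hlip : ∀ ω, ∀ x ∈ W, ∀ y ∈ W, |f ω x - f ω y| ≤ L * ‖x - y‖)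
    {a c : EuclideanSpace ℝ (Fin d)} (hc : c ∈ W) (ha : a ∈ W) : ‖c - a‖ ≤ 4 * L / α := by
  obtain ⟨ω₀, hω₀⟩ := hconv.choose_spec.2.exists
  have hW : Convex ℝ W := hω₀.1
  have hs : (1 / 2 : ℝ) ∈ Set.Icc (0 : ℝ) 1 := by constructor <;> norm_num
  have hq := hW.add_smul_sub_mem hc ha hs
  have h := integral_mul_convexDefect_const_le (B := 1) hm hs hconv hint ha hc
    stronglyMeasurable_const (w := fun _ => 1) (fun _ => zero_le_one) fun _ => le_rfl
  have hi : Integrable (fun ω => 1 * convexDefect α (1 / 2) (f ω) a c) μ :=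
    (((hint _ hq).sub (((hint _ hc).const_mul _).add ((hint _ ha).const_mul _))).add
      (integrable_const _)).const_mul 1
  -- The midpoint lies at distance `‖c - a‖ / 2` from both ends, which bounds its defect from below,
  -- while the mean defect is at most `0`.
  have hlow : α / 8 * ‖c - a‖ ^ 2 - L / 2 * ‖c - a‖
      ≤ ∫ ω, 1 * convexDefect α (1 / 2) (f ω) a c ∂μ := by
    have h1 := integral_mono (μ := μ)
      (integrable_const (α / 8 * ‖c - a‖ ^ 2 - L / 2 * ‖c - a‖)) hi (fun ω => by
        have h2 := (abs_le.1 (hlip ω _ hq _ hc)).1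
        have h3 := (abs_le.1 (hlip ω _ hq _ ha)).1
        have e1 : c + (1 / 2 : ℝ) • (a - c) - c = (1 / 2 : ℝ) • (a - c) := by module
        have e2 : c + (1 / 2 : ℝ) • (a - c) - a = (1 / 2 : ℝ) • (c - a) := by module
        rw [e1, norm_smul, norm_sub_rev] at h2
        rw [e2, norm_smul] at h3
        norm_num at h2 h3
        simp only [convexDefect]
        norm_num
        linarith)
    simpa using h1
  rw [le_div_iff₀ hα]
  rcases (norm_nonneg (c - a)).eq_or_lt with h0 | h0
  · rw [← h0]; linarith
  · have : ‖c - a‖ * (‖c - a‖ * α) ≤ ‖c - a‖ * (4 * L) := by nlinarith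
    exact le_of_mul_le_mul_left this h0

lemma gradDefect_le {f : EuclideanSpace ℝ (Fin d) → ℝ} {D : ℝ} {a c v : EuclideanSpace ℝ (Fin d)}
    (hα : 0 ≤ α) (hL : 0 ≤ L) (hf : |f c - f a| ≤ L * ‖c - a‖)
    (hv : |inner ℝ v (c - a)| ≤ L * ‖c - a‖) (hD : ‖c - a‖ ≤ D) :
    |gradDefect α f a c v| ≤ 2 * L * D + α * D ^ 2 := by
  have h1 : α * ‖c - a‖ ^ 2 ≤ α * D ^ 2 := by gcongr
  have h2 : 0 ≤ α * ‖c - a‖ ^ 2 := by positivity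
  have h3 : L * ‖c - a‖ ≤ L * D := by gcongr
  rw [abs_le] at hf hv ⊢
  unfold gradDefect
  constructor <;> linarith

/-- A conditional exponential moment bound for the first-order strong convexity defect. -/
lemma integral_mul_exp_gradDefect_le (hm : m ≤ m₀) (hα : 0 < α) (hL : 0 < L)
    (hconv : CondStronglyConvex μ m W α f) (hint : ∀ x ∈ W, Integrable (fun ω => f ω x) μ)
    (hmeas : ∀ x ∈ W, StronglyMeasurable fun ω => f ω x)
    (hlip : ∀ ω, ∀ x ∈ W, ∀ y ∈ W, |f ω x - f ω y| ≤ L * ‖x - y‖)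
    {a : EuclideanSpace ℝ (Fin d)} (ha : a ∈ W) {y v : Ω → EuclideanSpace ℝ (Fin d)}
    (hy : StronglyMeasurable[m] y) (hyW : ∀ ω, y ω ∈ W)
    (hv : ∀ ω, HasGradientWithinAt (f ω) (v ω) W (y ω)) {V : Ω → ℝ} {B : ℝ}
    (hV : StronglyMeasurable[m] V) (hV0 : ∀ ω, 0 ≤ V ω) (hVB : ∀ ω, V ω ≤ B) :
    ∫ ω, V ω * Real.exp (α / (64 * L ^ 2) * gradDefect (7 / 16 * α) (f ω) a (y ω) (v ω)) ∂μ
      ≤ ∫ ω, V ω ∂μ := by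
  obtain ⟨ω₀, hω₀⟩ := hconv.choose_spec.2.exists
  have hW : Convex ℝ W := hω₀.1
  have hD : ∀ x ∈ W, ∀ y ∈ W, ‖x - y‖ ≤ 4 * L / α := fun x hx y hy =>
    hconv.norm_sub_le hm hα hL.le hint hlip hx hy
  set D := 4 * L / α with hD_def
  set l := α / (64 * L ^ 2) with hl
  have hl0 : 0 < l := by positivity
  -- The quadratic part of the exponent is `m`-measurable and joins the weight; only the linear part
  -- `X` remains to be expanded.
  let w : Ω → ℝ := fun ω => V ω * Real.exp (l * (7 / 16 * α * ‖y ω - a‖ ^ 2))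
  have hw : StronglyMeasurable[m] w := hV.mul (Real.continuous_exp.comp_stronglyMeasurable
    ((((hy.sub stronglyMeasurable_const).norm.pow 2).const_mul _).const_mul _))
  have hw0 : ∀ ω, 0 ≤ w ω := fun ω => mul_nonneg (hV0 ω) (Real.exp_pos _).le
  have hwB : ∀ ω, w ω ≤ B * Real.exp (l * (7 / 16 * α * D ^ 2)) := fun ω => by
    have h1 : Real.exp (l * (7 / 16 * α * ‖y ω - a‖ ^ 2)) ≤ Real.exp (l * (7 / 16 * α * D ^ 2)) := by
      have := hD _ (hyW ω) _ ha
      gcongr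
    exact mul_le_mul (hVB ω) h1 (Real.exp_pos _).le ((hV0 ω).trans (hVB ω))
  have hgrad : ∀ ω, |inner ℝ (v ω) (y ω - a)| ≤ L * ‖y ω - a‖ := fun ω =>
    abs_inner_gradient_le hW (hlip ω) (hyW ω) (hyW ω) ha (hv ω)
  have hdef : ∀ α' : ℝ, 0 ≤ α' → ∀ ω,
      |gradDefect α' (f ω) a (y ω) (v ω)| ≤ 2 * L * D + α' * D ^ 2 := fun α' hα' ω =>
    gradDefect_le hα' hL.le (hlip ω _ (hyW ω) _ ha) (hgrad ω) (hD _ (hyW ω) _ ha)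
  have hdm : ∀ α' : ℝ, StronglyMeasurable fun ω => gradDefect α' (f ω) a (y ω) (v ω) := fun α' =>
    stronglyMeasurable_gradDefect hW hmeas hlip ha (hy.mono hm) hyW hv
  have hiV : Integrable V μ := Integrable.of_bound (hV.mono hm).aestronglyMeasurable B
    (Filter.Eventually.of_forall fun ω => by rw [Real.norm_of_nonneg (hV0 ω)]; exact hVB ω)
  have hiw : Integrable w μ := Integrable.of_bound (hw.mono hm).aestronglyMeasurable _
    (Filter.Eventually.of_forall fun ω => by rw [Real.norm_of_nonneg (hw0 ω)]; exact hwB ω)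
  have hi1 : Integrable (fun ω => w ω * gradDefect (α / 2) (f ω) a (y ω) (v ω)) μ :=
    hiw.mul_bdd (hdm _).aestronglyMeasurable
      (Filter.Eventually.of_forall fun ω => hdef (α / 2) (by positivity) ω)
  have hi2 : Integrable (fun ω => V ω * Real.exp (l * gradDefect (7 / 16 * α) (f ω) a (y ω) (v ω)))
      μ := by
    refine hiV.mul_bdd (c := Real.exp (l * (2 * L * D + 7 / 16 * α * D ^ 2)))
      (Real.continuous_exp.comp_stronglyMeasurable ((hdm _).const_mul _)).aestronglyMeasurable
      (Filter.Eventually.of_forall fun ω => ?_)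
    rw [Real.norm_of_nonneg (Real.exp_pos _).le]
    have := (le_abs_self _).trans (hdef (7 / 16 * α) (by positivity) ω)
    gcongr
  have hkey := integral_mul_gradDefect_le hm hα.le hL.le hconv hint hmeas hlip hD ha hy hyW hv
    hw hw0 hwB
  have hpt : ∀ ω, V ω * Real.exp (l * gradDefect (7 / 16 * α) (f ω) a (y ω) (v ω))
      ≤ V ω + l * (w ω * gradDefect (α / 2) (f ω) a (y ω) (v ω)) := by
    intro ω
    set X := f ω (y ω) - f ω a - inner ℝ (v ω) (y ω - a) with hX
    set R := ‖y ω - a‖ with hR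
    have hR0 : 0 ≤ R := norm_nonneg _
    have hRD : R ≤ 4 * L / α := hD _ (hyW ω) _ ha
    have e1 : gradDefect (7 / 16 * α) (f ω) a (y ω) (v ω) = X + 7 / 16 * α * R ^ 2 := rfl
    have e2 : gradDefect (α / 2) (f ω) a (y ω) (v ω) = X + α / 2 * R ^ 2 := rfl
    rw [e1, e2]
    have hXR : |X| ≤ 2 * L * R := by
      have h1 := abs_sub (f ω (y ω) - f ω a) (inner ℝ (v ω) (y ω - a))
      have h2 := hlip ω _ (hyW ω) _ ha
      have h3 := hgrad ω
      linarith
    have hu : |l * X| ≤ 1 := by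
      rw [abs_mul, abs_of_pos hl0]
      calc _ ≤ l * (2 * L * (4 * L / α)) := by gcongr; exact hXR.trans (by gcongr)
        _ = 1 / 8 := by rw [hl]; field_simp; norm_num
        _ ≤ 1 := by norm_num
    -- This fixes `l = α / (64 * L ^ 2)`: the second-order term of the exponential fits into the gap
    -- `1/2 - 7/16 = 1/16`.
    have hu2 : (l * X) ^ 2 ≤ l * (α / 16 * R ^ 2) := by
      calc (l * X) ^ 2 = l ^ 2 * |X| ^ 2 := by rw [mul_pow, sq_abs]
        _ ≤ l ^ 2 * (2 * L * R) ^ 2 := by gcongr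
        _ = l * (α / 16 * R ^ 2) := by rw [hl]; field_simp; ring
    have hexp := (abs_le.1 (Real.abs_exp_sub_one_sub_id_le hu)).2
    have hq := Real.add_one_le_exp (-(l * (7 / 16 * α * R ^ 2)))
    have hwV : w ω * Real.exp (-(l * (7 / 16 * α * R ^ 2))) = V ω := by
      simp only [w]
      rw [mul_assoc, ← Real.exp_add, add_neg_cancel, Real.exp_zero, mul_one]
    calc V ω * Real.exp (l * (X + 7 / 16 * α * R ^ 2)) = w ω * Real.exp (l * X) := by
          simp only [w]
          rw [mul_add, Real.exp_add]; ring
      -- From `exp (l X) ≤ 1 + l X + (l X)²` and `1 - q ≤ exp (-q)`; the factor `exp (-q)` turns `w`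
      -- back into `V`.
      _ ≤ w ω * (Real.exp (-(l * (7 / 16 * α * R ^ 2))) + l * (X + α / 2 * R ^ 2)) := by
          refine mul_le_mul_of_nonneg_left ?_ (hw0 ω)
          linarith
      _ = _ := by rw [mul_add, hwV]; ring
  calc _ ≤ ∫ ω, (V ω + l * (w ω * gradDefect (α / 2) (f ω) a (y ω) (v ω))) ∂μ :=
        integral_mono hi2 (hiV.add (hi1.const_mul l)) hpt
    _ = ∫ ω, V ω ∂μ + l * ∫ ω, w ω * gradDefect (α / 2) (f ω) a (y ω) (v ω) ∂μ := by
        rw [integral_add hiV (hi1.const_mul l), integral_const_mul]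
    _ ≤ _ := by
        have := mul_nonpos_of_nonneg_of_nonpos hl0.le hkey
        linarith

end Concentration

/-! ### From the net to all comparators. -/

lemma gradDefect_le_of_norm_sub_le {d : ℕ} {α L ρ : ℝ} {f : EuclideanSpace ℝ (Fin d) → ℝ}
    {p q c v : EuclideanSpace ℝ (Fin d)} (hα : 0 ≤ α) (hL : 0 ≤ L)
    (hf : |f p - f q| ≤ L * ‖p - q‖) (hv : |inner ℝ v (p - q)| ≤ L * ‖p - q‖)
    (hρ : ‖q - p‖ ≤ ρ) :
    gradDefect (3 / 8 * α) f q c v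
      ≤ gradDefect (7 / 16 * α) f p c v + (2 * (L * ρ) + 3 * α * ρ ^ 2) := by
  have h1 := (le_abs_self _).trans hf
  have h2 := (neg_le_abs _).trans hv
  rw [norm_sub_rev p q] at h1 h2
  have h3 : L * ‖q - p‖ ≤ L * ρ := by gcongr
  have h4 : ‖c - q‖ ≤ ‖c - p‖ + ρ := by
    have := norm_sub_le_norm_sub_add_norm_sub c p q
    rw [norm_sub_rev p q] at this
    linarith
  have h5 : 3 / 8 * ‖c - q‖ ^ 2 ≤ 7 / 16 * ‖c - p‖ ^ 2 + 3 * ρ ^ 2 := by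
    have : ‖c - q‖ ^ 2 ≤ (‖c - p‖ + ρ) ^ 2 := by gcongr
    nlinarith [sq_nonneg (‖c - p‖ - 6 * ρ)]
  have h6 := mul_le_mul_of_nonneg_left h5 hα
  unfold gradDefect
  simp only [inner_sub_right] at *
  linarith

lemma log_card_grid_le {d T k : ℕ} {δ : ℝ} (hd : 1 ≤ d) (hT : 3 ≤ T) (hk : 0 < k) (hkT : k ≤ T)
    (hδ0 : 0 < δ) (hδ1 : δ < 1) :
    Real.log (k * ((2 * T + 1) ^ d : ℕ) / δ) ≤ 3 * d * Real.log (T / δ) := by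
  have hk0 : (0 : ℝ) < k := by exact_mod_cast hk
  have hT3 : (3 : ℝ) ≤ T := by exact_mod_cast hT
  have hT0 : (0 : ℝ) < T := by linarith
  have hd1 : (1 : ℝ) ≤ d := by exact_mod_cast hd
  push_cast
  rw [Real.log_div (by positivity) hδ0.ne', Real.log_mul hk0.ne' (by positivity), Real.log_pow,
    Real.log_div hT0.ne' hδ0.ne']
  have h1 : Real.log k ≤ Real.log T := Real.log_le_log hk0 (by exact_mod_cast hkT)
  have h2 : Real.log (2 * T + 1) ≤ 2 * Real.log T := by
    have := Real.log_le_log (by positivity) (show (2 * T + 1 : ℝ) ≤ T ^ 2 by nlinarith)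
    rwa [Real.log_pow] at this
  have h3 : Real.log δ ≤ 0 := Real.log_nonpos hδ0.le hδ1.le
  have h4 : 0 ≤ Real.log T := Real.log_nonneg (by linarith)
  nlinarith [mul_le_mul_of_nonneg_left h2 (zero_le_one.trans hd1),
    mul_nonneg (sub_nonneg.2 hd1) h4, mul_nonneg (sub_nonneg.2 hd1) (neg_nonneg.2 h3)]

lemma one_le_log_natCast {T : ℕ} (hT : 3 ≤ T) : 1 ≤ Real.log T := by
  have hT3 : (3 : ℝ) ≤ T := by exact_mod_cast hT
  rw [Real.le_log_iff_exp_le (by linarith)]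
  linarith [Real.exp_one_lt_d9]

/-- With high probability, the summed first-order strong convexity defects at delayed adapted
points are bounded, uniformly over the comparator. -/
lemma exists_event_sum_gradDefect_le {Ω : Type*} {m₀ : MeasurableSpace Ω} {μ : Measure Ω}
    [IsProbabilityMeasure μ] {ℱ : Filtration ℕ m₀} {d T k : ℕ}
    {W : Set (EuclideanSpace ℝ (Fin d))} {α β L : ℝ}
    {f : ℕ → Ω → EuclideanSpace ℝ (Fin d) → ℝ}
    {Df : ℕ → Ω → EuclideanSpace ℝ (Fin d) → EuclideanSpace ℝ (Fin d)}
    {x : ℕ → Ω → EuclideanSpace ℝ (Fin d)}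
    (hd : 1 ≤ d) (hk : 0 < k) (hkT : k < T) (hT : 3 ≤ T) (hα : 0 < α) (hL : 0 < L)
    (hW : Convex ℝ W) (hreg : Regularity μ ℱ W T k α β L f Df)
    (hx : ∀ t < T, StronglyMeasurable[ℱ t] (x t)) (hxW : ∀ t < T, ∀ ω, x t ω ∈ W)
    {δ : ℝ} (hδ0 : 0 < δ) (hδ1 : δ < 1) :
    ∃ A : Set Ω, MeasurableSet A ∧ ENNReal.ofReal (1 - δ) ≤ μ A ∧ ∀ ω ∈ A, ∀ xs ∈ W,
      ∑ t ∈ Finset.Ico k T,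
          gradDefect (3 / 8 * α) (f t ω) xs (x (t - k) ω) (Df t ω (x (t - k) ω))
        ≤ 250 * (k * d * L ^ 2 / α * Real.log (T / δ)) := by
  have hT0 : (0 : ℝ) < T := by exact_mod_cast (show 0 < T by omega)
  have hT1 : (1 : ℝ) ≤ T := by exact_mod_cast (show 1 ≤ T by omega)
  have hd1 : (1 : ℝ) ≤ d := by exact_mod_cast hd
  have hk1 : (1 : ℝ) ≤ k := by exact_mod_cast hk
  have hint : ∀ t < T, ∀ y ∈ W, Integrable (fun ω => f t ω y) μ := hreg.integrable
  have hD : ∀ y ∈ W, ∀ z ∈ W, ‖y - z‖ ≤ 4 * L / α := fun y hy z hz =>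
    (hreg.condStronglyConvex k le_rfl hkT).norm_sub_le (ℱ.le _) hα hL.le (hint k hkT)
      (hreg.lipschitz k hkT) hy hz
  have : Nonempty Ω := nonempty_of_isProbabilityMeasure μ
  obtain ⟨ω₀⟩ := this
  have hx₀ : x 0 ω₀ ∈ W := hxW 0 (by omega) ω₀
  -- With resolution `T`, the approximation error summed over `T` rounds is `O(d * L ^ 2 / α)`, and
  -- the logarithm of the size of the net is `O(d * log T)`.
  obtain ⟨p, hpW, hp⟩ := exists_grid_net hx₀ (D := 4 * L / α) (by positivity)
    (fun y hy => hD y hy _ hx₀) (show 0 < T by omega)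
  set l := α / (64 * L ^ 2) with hl
  have hl0 : 0 < l := by positivity
  have hinner : ∀ t < T, ∀ ω, ∀ y ∈ W, ∀ a ∈ W, ∀ b ∈ W,
      |inner ℝ (Df t ω y) (a - b)| ≤ L * ‖a - b‖ := fun t ht ω y hy a ha b hb =>
    abs_inner_gradient_le hW (hreg.lipschitz t ht ω) hy ha hb (hreg.gradient t ht ω y hy)
  let Z : (Fin d → Fin (2 * T + 1)) → ℕ → Ω → ℝ := fun i t ω =>
    l * gradDefect (7 / 16 * α) (f t ω) (p i) (x (t - k) ω) (Df t ω (x (t - k) ω))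
  have hZm : ∀ i t, k ≤ t → t < T → StronglyMeasurable[ℱ t] (Z i t) := fun i t hkt htT =>
    (stronglyMeasurable_gradDefect hW (hreg.adapted t htT) (hreg.lipschitz t htT) (hpW i)
      ((hx (t - k) (by omega)).mono (ℱ.mono (Nat.sub_le t k))) (hxW (t - k) (by omega))
      fun ω => hreg.gradient t htT ω _ (hxW (t - k) (by omega) ω)).const_mul l
  have hZb : ∀ i t, k ≤ t → t < T → ∀ ω,
      Z i t ω ≤ l * (2 * L * (4 * L / α) + 7 / 16 * α * (4 * L / α) ^ 2) := by
    intro i t hkt htT ω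
    have hy := hxW (t - k) (by omega) ω
    refine mul_le_mul_of_nonneg_left ((le_abs_self _).trans ?_) hl0.le
    exact gradDefect_le (by positivity) hL.le (hreg.lipschitz t htT ω _ hy _ (hpW i))
      (hinner t htT ω _ hy _ hy _ (hpW i)) (hD _ hy _ (hpW i))
  have hexp : ∀ i r, ∫ ω, Real.exp (∑ t ∈ Finset.Ico k T with t % k = r, Z i t ω) ∂μ ≤ 1 := by
    intro i r
    refine integral_exp_sum_le_one (ℱ := ℱ) (hZm i) (hZb i) ?_ r le_rfl
    intro t hkt htT V B hV hV0 hVB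
    exact integral_mul_exp_gradDefect_le (ℱ.le _) hα hL (hreg.condStronglyConvex t hkt htT)
      (hint t htT) (fun y hy => (hreg.adapted t htT y hy).mono (ℱ.le t)) (hreg.lipschitz t htT)
      (hpW i) (hx (t - k) (by omega)) (hxW (t - k) (by omega))
      (fun ω => hreg.gradient t htT ω _ (hxW (t - k) (by omega) ω)) hV hV0 hVB
  obtain ⟨A, hA, hμA, hAω⟩ := exists_event_sum_le hk
    (fun i t hkt htT => (hZm i t hkt htT).mono (ℱ.le t)) hZb hexp hδ0
  refine ⟨A, hA, hμA, fun ω hω xs hxs => ?_⟩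
  obtain ⟨i, hi⟩ := hp xs hxs
  set ρ := √d * (4 * L / α / T) with hρ
  have h1 := hAω ω hω i
  simp only [Z] at h1
  rw [← Finset.mul_sum, Fintype.card_fun, Fintype.card_fin, Fintype.card_fin] at h1
  have h2 := h1.trans (mul_le_mul_of_nonneg_left
    (log_card_grid_le hd hT hk hkT.le hδ0 hδ1) (Nat.cast_nonneg k))
  set Λ := Real.log (T / δ) with hΛ
  have hΛ1 : 1 ≤ Λ := by
    refine (one_le_log_natCast hT).trans (Real.log_le_log hT0 ?_)
    rw [le_div_iff₀ hδ0]
    nlinarith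
  have h3 : ∑ t ∈ Finset.Ico k T,
      gradDefect (7 / 16 * α) (f t ω) (p i) (x (t - k) ω) (Df t ω (x (t - k) ω))
      ≤ 192 * (k * d * L ^ 2 / α * Λ) := by
    have h4 := mul_le_mul_of_nonneg_left h2 (inv_pos.2 hl0).le
    rw [inv_mul_cancel_left₀ hl0.ne'] at h4
    refine h4.trans_eq ?_
    rw [hl]; field_simp; ring
  have hρ0 : 0 ≤ ρ := by positivity
  have h5 : T * (2 * (L * ρ) + 3 * α * ρ ^ 2) ≤ 56 * (k * d * L ^ 2 / α * Λ) := by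
    have hs : √(d : ℝ) ≤ d := by
      rw [Real.sqrt_le_left (by linarith)]
      nlinarith
    have h6 : T * (2 * (L * ρ)) ≤ 8 * (d * L ^ 2 / α) := by
      calc _ = 8 * (√d * L ^ 2 / α) := by rw [hρ]; field_simp; ring
        _ ≤ _ := by gcongr
    have h7 : T * (3 * α * ρ ^ 2) ≤ 48 * (d * L ^ 2 / α) := by
      calc _ = 48 * (d * L ^ 2 / α) / T := by
            rw [hρ, mul_pow, Real.sq_sqrt (by positivity)]; field_simp; ring
        _ ≤ _ := div_le_self (by positivity) hT1
    have h8 : d * L ^ 2 / α ≤ k * d * L ^ 2 / α * Λ := by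
      have h9 : 0 ≤ d * L ^ 2 / α := by positivity
      calc _ = 1 * (d * L ^ 2 / α) * 1 := by ring
        _ ≤ k * (d * L ^ 2 / α) * Λ := by gcongr
        _ = _ := by ring
    linarith
  calc _ ≤ ∑ t ∈ Finset.Ico k T,
        (gradDefect (7 / 16 * α) (f t ω) (p i) (x (t - k) ω) (Df t ω (x (t - k) ω))
          + (2 * (L * ρ) + 3 * α * ρ ^ 2)) := by
        refine Finset.sum_le_sum fun t ht => ?_
        have htT := (Finset.mem_Ico.1 ht).2
        exact gradDefect_le_of_norm_sub_le hα.le hL.le (hreg.lipschitz t htT ω _ (hpW i) _ hxs)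
          (hinner t htT ω _ (hxW (t - k) (by omega) ω) _ (hpW i) _ hxs) hi
    _ ≤ 192 * (k * d * L ^ 2 / α * Λ) + T * (2 * (L * ρ) + 3 * α * ρ ^ 2) := by
        rw [Finset.sum_add_distrib, Finset.sum_const, Nat.card_Ico, nsmul_eq_mul]
        gcongr
        exact Nat.sub_le T k
    _ ≤ _ := by
        have : 0 ≤ k * d * L ^ 2 / α * Λ := by positivity
        linarith

end OCOMemory

/-! ### Assembly. -/

theorem proposition3 :
    ∃ C : ℝ, 0 < C ∧
      ∀ {Ω : Type*} {m₀ : MeasurableSpace Ω} (μ : Measure Ω) [IsProbabilityMeasure μ]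
        (ℱ : Filtration ℕ m₀) (d T τ k h : ℕ) (W : Set (EuclideanSpace ℝ (Fin d)))
        (α β Lf Lc Lg G : ℝ)
        (F : ℕ → Ω → (Fin (h + 1) → EuclideanSpace ℝ (Fin d)) → ℝ)
        (Df : ℕ → Ω → EuclideanSpace ℝ (Fin d) → EuclideanSpace ℝ (Fin d))
        (ε x : ℕ → Ω → EuclideanSpace ℝ (Fin d)),
        1 ≤ τ → τ < k → k < T → 1 ≤ h → h < k →
        0 < α → 0 ≤ Lf → 0 ≤ Lc →
        Convex ℝ W →
        -- regularity of the induced unary losses, with gradients `Df`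
        OCOMemory.Regularity μ ℱ W T k α β Lf (fun t ω => OCOMemory.unary (F t ω)) Df →
        (∀ t < T, ∀ ω, OCOMemory.CoordLipschitz W Lc (F t ω)) →
        -- the diameter of `W` is at most `G`, and the inexact gradients are bounded by `Lg`
        (∀ y ∈ W, ∀ z ∈ W, ‖y - z‖ ≤ G) →
        (∀ t < T, ∀ ω, ‖Df t ω (x t ω) + ε t ω‖ ≤ Lg) →
        -- the iterates come from the algorithm and are adapted to the filtration
        (∀ ω, OCOMemory.IsDelayedPGD W T τ (fun t => 3 / (α * t))
          (fun t => Df t ω (x t ω) + ε t ω) (fun t => x t ω)) →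
        (∀ t < T, StronglyMeasurable[ℱ t] (x t)) →
        ∀ δ : ℝ, 0 < δ →
          ∃ A : Set Ω, MeasurableSet A ∧ ENNReal.ofReal (1 - δ) ≤ μ A ∧
            ∀ ω ∈ A, ∀ xs ∈ W,
              ∑ t ∈ Finset.Ico k T,
                  (F t ω (fun j : Fin (h + 1) => x (t - (j : ℕ)) ω)
                    - OCOMemory.unary (F t ω) xs)
                ≤ -(α / 12) * ∑ t ∈ Finset.range T, ‖x t ω - xs‖ ^ 2
                  + C * (∑ t ∈ Finset.Ico k T, ‖ε t ω‖ ^ 2 / α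
                    + k * d * Lf ^ 2 / α
                        * Real.log (T * (1 + Real.log (max 1 (α * G ^ 2))) / δ)
                    + α * G ^ 2 * (k + τ)
                    + Lg / α * (Lg * τ + (β * G + Lf) * k + Lc * h ^ 2) * Real.log T) := by
  -- The concentration bound sets the constant, `192 + 56 ≤ 250`; the deterministic terms need at
  -- most `12`.
  refine ⟨250, by norm_num, ?_⟩
  intro Ω m₀ μ _ ℱ d T τ k h W α β Lf Lc Lg G F Df ε x hτ hτk hkT _ hhk hα hLf hLc hW hreg hF hG
    hg hx hxm δ hδ0
  by_cases hδ1 : 1 ≤ δ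
  · refine ⟨∅, MeasurableSet.empty, ?_, fun ω hω => absurd hω (Set.notMem_empty ω)⟩
    rw [ENNReal.ofReal_of_nonpos (by linarith)]
    exact zero_le
  push Not at hδ1
  have hT : 3 ≤ T := by omega
  have hT0 : (0 : ℝ) < T := by exact_mod_cast (show 0 < T by omega)
  have hlogT := OCOMemory.one_le_log_natCast hT
  have hxW : ∀ t ≤ T + τ, ∀ ω, x t ω ∈ W := fun t ht ω => (hx ω).mem ht
  obtain ⟨ω₀⟩ := nonempty_of_isProbabilityMeasure μ
  have hx₀ := hxW 0 (by omega) ω₀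
  have hβ : 0 ≤ β := by
    obtain ⟨H, _, hH⟩ := hreg.hessian 0 (by omega) ω₀ _ hx₀
    exact (norm_nonneg H).trans hH
  have hLg : 0 ≤ Lg := (norm_nonneg _).trans (hg 0 (by omega) ω₀)
  have hG0 : 0 ≤ G := (norm_nonneg _).trans (hG _ hx₀ _ hx₀)
  have hlogle : Real.log (T / δ) ≤ Real.log (T * (1 + Real.log (max 1 (α * G ^ 2))) / δ) := by
    refine Real.log_le_log (by positivity) ?_
    gcongr
    have : 0 ≤ Real.log (max 1 (α * G ^ 2)) := Real.log_nonneg (le_max_left _ _)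
    nlinarith
  have hlog0 : 0 ≤ Real.log (T / δ) := by
    refine Real.log_nonneg ?_
    rw [le_div_iff₀ hδ0]
    have : (3 : ℝ) ≤ T := by exact_mod_cast hT
    linarith
  have hlog0' := hlog0.trans hlogle
  -- If `W` is a single point the regret vanishes. Otherwise `1 ≤ d`, and the diameter bound `4 * Lf
  -- / α` forces `0 < Lf`, as the choice of the exponential scale requires.
  by_cases hsub : W.Subsingleton
  · refine ⟨Set.univ, MeasurableSet.univ, ?_, fun ω _ xs hxs => ?_⟩
    · rw [measure_univ, ENNReal.ofReal_le_one]; linarith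
    · have hxeq : ∀ t ≤ T + τ, x t ω = xs := fun t ht => hsub (hxW t ht ω) hxs
      have h1 : ∑ t ∈ Finset.Ico k T, (F t ω (fun j : Fin (h + 1) => x (t - (j : ℕ)) ω)
          - OCOMemory.unary (F t ω) xs) = 0 := by
        refine Finset.sum_eq_zero fun t ht => ?_
        have htT := (Finset.mem_Ico.1 ht).2
        have e : (fun j : Fin (h + 1) => x (t - (j : ℕ)) ω) = fun _ => xs :=
          funext fun j => hxeq _ (by omega)
        rw [e, OCOMemory.unary, sub_self]
      have h2 : ∑ t ∈ Finset.range T, ‖x t ω - xs‖ ^ 2 = 0 := by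
        refine Finset.sum_eq_zero fun t ht => ?_
        rw [hxeq t (by have := Finset.mem_range.1 ht; omega)]
        simp
      rw [h1, h2, mul_zero, zero_add]
      positivity
  · rw [Set.not_subsingleton_iff] at hsub
    obtain ⟨a, ha, b, hb, hab⟩ := hsub
    have hd : 1 ≤ d := by
      by_contra hd0
      obtain rfl : d = 0 := by omega
      exact hab (Subsingleton.elim a b)
    have hLf0 : 0 < Lf := by
      have h1 := (hreg.condStronglyConvex k le_rfl hkT).norm_sub_le (ℱ.le _) hα hLf
        (hreg.integrable k hkT) (hreg.lipschitz k hkT) ha hb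
      have h2 : 0 < ‖a - b‖ := norm_pos_iff.2 (sub_ne_zero.2 hab)
      rcases hLf.eq_or_lt with h0 | h0
      · rw [← h0, mul_zero, zero_div] at h1; linarith
      · exact h0
    obtain ⟨A, hA, hμA, hAω⟩ := OCOMemory.exists_event_sum_gradDefect_le hd (by omega) hkT hT hα
      hLf0 hW hreg hxm (fun t ht => hxW t (by omega)) hδ0 hδ1
    refine ⟨A, hA, hμA, fun ω hω xs hxs => ?_⟩
    have hhess : ∀ t < T, ∀ y ∈ W, ∀ z ∈ W, ‖Df t ω y - Df t ω z‖ ≤ β * ‖y - z‖ := by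
      intro t ht y hy z hz
      choose! H hH using hreg.hessian t ht ω
      exact hW.norm_image_sub_le_of_norm_hasFDerivWithin_le (fun w hw => (hH w hw).1)
        (fun w hw => (hH w hw).2) hz hy
    have hmain := (hx ω).regret_le hτ hτk hkT hhk hα hβ hLf hLc hW
      (fun t ht => hreg.lipschitz t ht ω)
      (fun t ht y hy a ha b hb => OCOMemory.abs_inner_gradient_le hW (hreg.lipschitz t ht ω) hy ha
        hb (hreg.gradient t ht ω y hy))
      hhess (fun t ht => hF t ht ω) hG (fun t ht => hg t ht ω) hxs (hAω ω hω xs hxs)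
    refine hmain.trans ?_
    have n1 : 0 ≤ ∑ t ∈ Finset.Ico k T, ‖ε t ω‖ ^ 2 / α := by positivity
    have n2 : 0 ≤ α * G ^ 2 * (k + τ) := by positivity
    have n3 : 0 ≤ Lg / α * (Lg * τ + (β * G + Lf) * k + Lc * h ^ 2) := by positivity
    have n4 : Lg / α * (Lg * τ + (β * G + Lf) * k + Lc * h ^ 2) * (1 + Real.log T)
        ≤ Lg / α * (Lg * τ + (β * G + Lf) * k + Lc * h ^ 2) * (2 * Real.log T) := by
      gcongr; linarith
    have n5 : 0 ≤ Lg / α * (Lg * τ + (β * G + Lf) * k + Lc * h ^ 2) * Real.log T := by positivity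
    have n6 : k * d * Lf ^ 2 / α * Real.log (T / δ) ≤ k * d * Lf ^ 2 / α
        * Real.log (T * (1 + Real.log (max 1 (α * G ^ 2))) / δ) := by gcongr
    linarith
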